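/- **Setting.** $\mathbb S^n\supset\mathbb S^n_+$ are the symmetric and the positive semidefinite real $n\times n$ matrices, $A\cdot B=\operatorname{tr}(A^{\rm T}B)$, $\|A\|_{\rm F}^2=A\cdot A$, $A^{\rm sym}=\frac12(A+A^{\rm T})$, and $A^\dagger$ is the pseudoinverse. For $X\in\mathbb S^n$ and matrices $Y,Z$ with $n$ rows let $J(X,Y,Z)=\frac12 Y\cdot X^\dagger Y+\frac12 Z\cdot X^\dagger Z$ if $X\in\mathbb S^n_+$ and $\operatorname{Ran}Y,\operatorname{Ran}Z\subset\operatorname{Ran}X$, and $J(X,Y,Z)=+\infty$ otherwise. Let $\Omega\subset\mathbb R^d$ be compact with nonempty interior and $Q=[0,1]\times\Omega$. Let $\mathsf D^*\Phi=A_0\Phi+\sum_j A_j\partial_j\Phi$, with $A_0,A_j:\mathbb S^n\to\mathbb R^{n\times k}$ linear, be a first-order operator with $\mathsf D^*(I)=0$. $\mathcal M(\Omega,\mathbb S^n_+)$ is the set of $\mathbb S^n_+$-valued Borel measures on $\Omega$. *Continuous problem.* For $\mathsf G_0,\mathsf G_1\in\mathcal M(\Omega,\mathbb S^n_+)$, $\mathcal{CE}_\infty(\mathsf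 G_0,\mathsf G_1)$ is the set of matrix-valued measures $\mu=(\mathsf G,\mathsf q,\mathsf R)$ on $Q$, with $\mathsf G$ symmetric, $\mathsf q$ of size $n\times k$ and $\mathsf R$ of size $n\times n$, such that $\int_Q\partial_t\Phi\cdot d\mathsf G+\mathsf D^*\Phi\cdot d\mathsf q+\Phi\cdot d\mathsf R=\int_\Omega\Phi_1\cdot d\mathsf G_1-\int_\Omega\Phi_0\cdot d\mathsf G_0$ for all $C^1$ functions $\Phi$ with values in $\mathbb S^n$, and $\int J(d\mu/d\lambda)\,d\lambda<\infty$ for a dominating measure $\lambda$. *Discretization.* Let $\Sigma\subset(0,\infty)$ accumulate at $0$, and let $(\mathcal T^\sigma,\mathcal V^\sigma)_{\sigma\in\Sigma}$ be a quasi-uniform family of conforming triangulations of $\Omega$ into finitely many nondegenerate $d$-simplices (sets of simplices and of vertices), with $\sigma=\max_{K}\operatorname{diam}K$. Let $\hat\phi_v$ be the piecewise linear nodal basis function of $v\in\mathcal V^\sigma$, $|T_v|=\int_\Omega\hat\phi_v\,dx$, and $\mathcal V_K^\sigma$ the set of vertices of $K$. Discrete fields are $G=(G_v)$ and $R=(R_v)$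 with $n\times n$ matrices at the vertices and $q=(q_K)$ with $q_K\in\mathbb R^{n\times k}$; ${\rm X}_{\sigma,+}$ is the set of $G$ with all $G_v\in\mathbb S^n_+$. The operator $\mathsf D_\sigma$ maps $q$ to the family $\mathsf D_\sigma q$ of symmetric matrices determined by $$\sum_v|T_v|\,S_v\cdot(\mathsf D_\sigma q)_v=-\sum_K\sum_{v\in\mathcal V^\sigma_K}q_K\cdot\int_K\mathsf D^*(S_v\hat\phi_v)\,dx\qquad\text{for all families }(S_v)\text{ in }\mathbb S^n ,$$ and $$\mathcal J_\sigma(G,q,R)=\sum_K|K|\,J\Big(\tfrac1{d+1}\sum_{v\in\mathcal V^\sigma_K}G_v,\,q_K,\,0\Big)+\sum_v|T_v|\,J(G_v,0,R_v).$$ For $N\ge1$, $\tau=1/N$ and $G^\sigma_0,G^\sigma_1\in{\rm X}_{\sigma,+}$, let $\mathcal{CE}_{\tau,\sigma}(G^\sigma_0,G^\sigma_1)$ be the set of discrete curves $\mu=\big((G_i)_{i=0}^N,(q_i)_{i=1}^N,(R_i)_{i=1}^N\big)$ with $G_i\in{\rm X}_{\sigma,+}$, $G_0=G^\sigma_0$,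 $G_N=G^\sigma_1$ and $\tau^{-1}(G_i-G_{i-1})=-\mathsf D_\sigma q_i+R_i^{\rm sym}$ for $1\le i\le N$; put $\mathcal J_{\tau,\sigma}(\mu)=\tau\sum_{i=1}^N\mathcal J_\sigma\big(\tfrac{G_{i-1}+G_i}2,q_i,R_i\big)$. The sampling of a measure $\mathsf G$ is $\mathcal S_\sigma\mathsf G=\big(|T_v|^{-1}\int\hat\phi_v\,d\mathsf G\big)_v$; a function is sampled as the measure on $\Omega$ with that Lebesgue density. *Regularization.* Assume that $\Omega$ is star-shaped with respect to every point of a set with $c$ in its interior, that $L$ is a Lipschitz constant of the Minkowski functional of $\Omega-c$, and that after a splitting $k=k_1+k_2$ of the columns $\mathsf D^*=(\mathsf D^*_0,\mathsf D_1^*)$ with $\mathsf D_0^*$ of order $0$ and $\mathsf D_1^*$ homogeneous of order $1$. Let $\Omega_r$ be the closed $r$-neighborhood of $\Omega$, let $\bar G\in C_c^\infty(\mathbb R^d,\mathbb S^n_+)$ be supported in $\Omega_1$ with $\bar G\succeq I$ on $\Omega_{1/2}$, and let $\rho_\varepsilon(t,x)=\varepsilon^{-1}\theta_1(t/\varepsilon)\,\varepsilon^{-d}\theta_d(x/\varepsilon)$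 with $\theta_1,\theta_d$ smooth, nonnegative, radial, supported in the closed unit balls and of integral $1$. For $\mu\in\mathcal{CE}_\infty(\mathsf G_0,\mathsf G_1)$, restrict $\mu$ to times in $(0,1)$, extend it by $(\mathsf G_0,0,0)$ for $t\le0$ and by $(\mathsf G_1,0,0)$ for $t\ge1$ (and by zero outside $\Omega$), replace the result by $(1-\varepsilon)\mu+\varepsilon(\bar G,0,0)$, convolve with $\rho_\varepsilon$, and restrict in space to a measurable set $U_\varepsilon\supset\Omega_\varepsilon$ (for instance $U_\varepsilon=\Omega_\varepsilon$). Then multiply the two blocks of columns of $\mathsf q$ by $1+2\varepsilon$ and $(1+2\varepsilon)(1+L\varepsilon)^{-1}$, multiply $\mathsf R$ by $1+2\varepsilon$, push forward at each time by $x\mapsto c+(1+L\varepsilon)^{-1}(x-c)$, and rescale time by $t\mapsto(t+\varepsilon)/(1+2\varepsilon)$. The resulting family of measures at times $s\in[0,1]$, considered on $\Omega$, is the $\varepsilon$-regularization $\mu^\varepsilon$ of $\mu$, with density $(G^\varepsilon,q^\varepsilon,R^\varepsilon)$; put $G_i^\varepsilon=G^\varepsilon(i,\cdot)$ for $i=0,1$.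 **Statement.** 1. For all $\sigma\in\Sigma$, $N\ge1$, $\tau=1/N$ and $G^\sigma_0,G^\sigma_1\in{\rm X}_{\sigma,+}$ there is $\mu^{\tau,\sigma}\in\mathcal{CE}_{\tau,\sigma}(G^\sigma_0,G^\sigma_1)$ with $$\mathcal J_{\tau,\sigma}(\mu^{\tau,\sigma})\le2\sum_{v\in\mathcal V^\sigma}|T_v|\,\Big\|\sqrt{G^\sigma_{1,v}}-\sqrt{G^\sigma_{0,v}}\Big\|_{\rm F}^2 ,$$ and $\mathcal J_{\tau,\sigma}$ has a minimizer on $\mathcal{CE}_{\tau,\sigma}(G^\sigma_0,G^\sigma_1)$. 2. For $\mathsf G_0,\mathsf G_1\in\mathcal M(\Omega,\mathbb S^n_+)$ the samplings $\mathsf G_i^\sigma=\mathcal S_\sigma\mathsf G_i$ belong to ${\rm X}_{\sigma,+}$, and for $i=0,1$ and every continuous $\Phi:\Omega\to\mathbb S^n$, $$\Big\langle\sum_{v\in\mathcal V^\sigma}|T_v|\,\mathsf G^\sigma_{i,v}\,\delta_v,\ \Phi\Big\rangle\to\langle\mathsf G_i,\Phi\rangle\qquad\text{as }\sigma\to0 .$$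 3. If moreover $\mathsf G_0$ and $\mathsf G_1$ are absolutely continuous with respect to Lebesgue measure, then assumption A* holds, for every admissible choice of the objects that enter the regularization: for every $\mu\in\mathcal{CE}_\infty(\mathsf G_0,\mathsf G_1)$ and $i=0,1$ there are, for all small $\varepsilon>0$, discrete curves $\mu_i^{\tau,\sigma}\in\mathcal{CE}_{\tau,\sigma}(\mathsf G_i^\sigma,\mathcal S_\sigma G_i^\varepsilon)$ for all $\tau=1/N$, $\sigma\in\Sigma$, such that $$\omega_{\varepsilon,i}=\limsup_{(\tau,\sigma)\to0}\mathcal J_{\tau,\sigma}(\mu_i^{\tau,\sigma})\to0\qquad\text{as }\varepsilon\to0 .$$ -/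

import Mathlib

open MeasureTheory Filter Topology Set
open scoped ENNReal NNReal Matrix ContDiff

noncomputable section

namespace MatrixOT

/-- The ambient space `ℝ^d` with its Euclidean norm. -/
abbrev Eucl (d : ℕ) := EuclideanSpace ℝ (Fin d)

/-- Real `n × m` matrices. -/
abbrev Mat (n m : ℕ) := Matrix (Fin n) (Fin m) ℝ

/-! ### Matrices -/

/-- The Frobenius inner product `A · B = tr (Aᵀ B)`. -/
def frob {n m : ℕ} (A B : Mat n m) : ℝ := (Aᵀ * B).trace

/-- The symmetric part `(A + Aᵀ) / 2`. -/
def symPart {n : ℕ} (A : Mat n n) : Mat n n := (1 / 2 : ℝ) • (A + Aᵀ)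

/-- The space `𝕊ⁿ` of symmetric matrices. -/
def SymMat (n : ℕ) : Submodule ℝ (Mat n n) where
  carrier := {A | Aᵀ = A}
  add_mem' {A B} hA hB := by
    simp only [mem_ofPred_eq] at hA hB ⊢
    rw [Matrix.transpose_add, hA, hB]
  zero_mem' := by simp
  smul_mem' c A hA := by
    simp only [mem_ofPred_eq] at hA ⊢
    rw [Matrix.transpose_smul, hA]

/-- The symmetric part, as an element of `𝕊ⁿ`. -/
def toSym {n : ℕ} (A : Mat n n) : SymMat n :=
  ⟨symPart A, by
    change (symPart A)ᵀ = symPart A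
    simp [symPart, Matrix.transpose_smul, add_comm]⟩

/-- The identity matrix, as an element of `𝕊ⁿ`. -/
def symOne (n : ℕ) : SymMat n := ⟨1, Matrix.transpose_one⟩

/-- The pseudoinverse of a symmetric matrix: if `A = O diag(λ) Oᵀ` then
`A† = O diag(λ†) Oᵀ`, with `λ† = λ⁻¹` for `λ ≠ 0` and `0† = 0`. -/
def pinv {n : ℕ} (A : Mat n n) : Mat n n := cfc (fun x : ℝ => x⁻¹) A

/-- The square root of a positive semidefinite matrix. -/
def msqrt {n : ℕ} (A : Mat n n) : Mat n n := cfc Real.sqrt A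

/-- `½ Y · X† Y` if `X` is positive semidefinite with `Ran Y ⊆ Ran X`, and `+∞` otherwise. -/
def quadCost {n m : ℕ} (X : Mat n n) (Y : Mat n m) : ℝ≥0∞ :=
  open Classical in
  if X.PosSemidef ∧ LinearMap.range Y.mulVecLin ≤ LinearMap.range X.mulVecLin then
    ENNReal.ofReal ((1 / 2) * frob Y (pinv X * Y))
  else ⊤

/-- The action density `J(X, Y, Z)` with weights `(I, I)`. -/
def actionDensity {n k : ℕ} (X : Mat n n) (Y : Mat n k) (Z : Mat n n) : ℝ≥0∞ :=
  quadCost X Y + quadCost X Z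

/-! ### Matrix-valued measures -/

section Measures

variable {α : Type*} [MeasurableSpace α]

/-- The `(i, j)` entry of a matrix-valued measure. -/
def entry {n m : ℕ} (μ : VectorMeasure α (Mat n m)) (i : Fin n) (j : Fin m) : SignedMeasure α :=
  μ.mapRange (Matrix.entryAddMonoidHom ℝ i j) (continuous_id.matrix_elem i j)

/-- `∫ f dμ` for a scalar function `f`. -/
def integralScalar {n m : ℕ} (μ : VectorMeasure α (Mat n m)) (f : α → ℝ) : Mat n m :=
  Matrix.of fun i j => (entry μ i j).integral f (ContinuousLinearMap.lsmul ℝ ℝ)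

/-- The duality pairing `⟨μ, Φ⟩ = ∫ Φ · dμ`. -/
def pairing {n m : ℕ} (μ : VectorMeasure α (Mat n m)) (Φ : α → Mat n m) : ℝ :=
  ∑ i, ∑ j, (entry μ i j).integral (fun x => Φ x i j) (ContinuousLinearMap.lsmul ℝ ℝ)

/-- `μ` vanishes outside `S`, so that it is a measure on `S`. -/
def ConcentratedOn {n m : ℕ} (S : Set α) (μ : VectorMeasure α (Mat n m)) : Prop :=
  ∀ B, MeasurableSet B → Disjoint B S → μ B = 0

/-- `μ` belongs to `𝓜(S, 𝕊ⁿ₊)`. -/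
def IsPSDMeasureOn {n : ℕ} (S : Set α) (μ : VectorMeasure α (Mat n n)) : Prop :=
  ConcentratedOn S μ ∧ ∀ B, MeasurableSet B → (μ B).PosSemidef

/-- The sum of the total variations of the entries; it is equivalent to `|μ|`. -/
def entryVariation {n m : ℕ} (μ : VectorMeasure α (Mat n m)) : Measure α :=
  ∑ i, ∑ j, (entry μ i j).variation

/-- The density `dμ/dν`. -/
def density {n m : ℕ} (μ : VectorMeasure α (Mat n m)) (ν : Measure α) (x : α) : Mat n m :=
  Matrix.of fun i j => (entry μ i j).rnDeriv ν x

end Measures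

/-- A triple `(𝖦, 𝗊, 𝖱)` of matrix-valued measures on `α`. -/
structure TripleMeasure (α : Type*) [MeasurableSpace α] (n k : ℕ) where
  G : VectorMeasure α (Mat n n)
  q : VectorMeasure α (Mat n k)
  R : VectorMeasure α (Mat n n)

/-- A reference measure that dominates all components of the triple. -/
def TripleMeasure.ref {α : Type*} [MeasurableSpace α] {n k : ℕ} (μ : TripleMeasure α n k) :
    Measure α :=
  entryVariation μ.G + entryVariation μ.q + entryVariation μ.R

/-- The action functional `∫ J(dμ/dλ) dλ`; by homogeneity of `J` it does not depend on the
reference measure `λ`. -/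
def TripleMeasure.action {α : Type*} [MeasurableSpace α] {n k : ℕ} (μ : TripleMeasure α n k) :
    ℝ≥0∞ :=
  ∫⁻ x, actionDensity (density μ.G μ.ref x) (density μ.q μ.ref x) (density μ.R μ.ref x) ∂μ.ref

/-! ### The differential operator and the continuity equation -/

/-- A first-order differential operator
`𝖣* Φ = A₀ Φ + ∑ j, A_j ∂_j Φ` with constant coefficients, from `𝕊ⁿ`-valued to
`ℝ^{n×k}`-valued functions on `ℝ^d`, such that `𝖣*(I) = 0`. -/
structure DiffOp (d n k : ℕ) where
  zeroth : SymMat n →ₗ[ℝ] Mat n k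
  first : Fin d → SymMat n →ₗ[ℝ] Mat n k
  zeroth_one : zeroth (symOne n) = 0

variable {d n k : ℕ}

/-- `(𝖣* Φ)(x)`. -/
def DiffOp.apply (D : DiffOp d n k) (Φ : Eucl d → SymMat n) (x : Eucl d) : Mat n k :=
  D.zeroth (Φ x) + ∑ j, D.first j (fderiv ℝ Φ x (EuclideanSpace.single j 1))

/-- The time-space domain `Q = [0,1] × Ω`. -/
def timeSpace (Ω : Set (Eucl d)) : Set (ℝ × Eucl d) := Icc 0 1 ×ˢ Ω

/-- `μ = (𝖦, 𝗊, 𝖱)` is a measure on `Q` with `𝖦` symmetric that solves the continuity equation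
with the endpoints `𝖦₀`, `𝖦₁`, in the weak form. -/
def InCE (Ω : Set (Eucl d)) (D : DiffOp d n k) (G₀ G₁ : VectorMeasure (Eucl d) (Mat n n))
    (μ : TripleMeasure (ℝ × Eucl d) n k) : Prop :=
  ConcentratedOn (timeSpace Ω) μ.G ∧ ConcentratedOn (timeSpace Ω) μ.q ∧
  ConcentratedOn (timeSpace Ω) μ.R ∧ (∀ B, (μ.G B).IsSymm) ∧
  ∀ Φ : ℝ × Eucl d → SymMat n,
    (∀ i j, ContDiff ℝ 1 fun p => (Φ p : Mat n n) i j) →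
    pairing μ.G (fun p => (fderiv ℝ (fun t => Φ (t, p.2)) p.1 1 : SymMat n))
      + pairing μ.q (fun p => D.apply (fun y => Φ (p.1, y)) p.2)
      + pairing μ.R (fun p => Φ p)
    = pairing G₁ (fun x => Φ (1, x)) - pairing G₀ (fun x => Φ (0, x))

/-- Solutions of the continuity equation with finite action. -/
def InCEFinite (Ω : Set (Eucl d)) (D : DiffOp d n k)
    (G₀ G₁ : VectorMeasure (Eucl d) (Mat n n)) (μ : TripleMeasure (ℝ × Eucl d) n k) : Prop :=
  InCE Ω D G₀ G₁ μ ∧ μ.action < ⊤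

/-! ### Triangulations -/

/-- A conforming triangulation of `Ω` by finitely many nondegenerate `d`-simplices, each given
by its vertices. -/
structure Mesh (d : ℕ) (Ω : Set (Eucl d)) where
  simplices : Finset (Finset (Eucl d))
  card_eq : ∀ K ∈ simplices, K.card = d + 1
  indep : ∀ K ∈ simplices, AffineIndependent ℝ ((↑) : K → Eucl d)
  conforming : ∀ K ∈ simplices, ∀ L ∈ simplices,
    convexHull ℝ (K : Set (Eucl d)) ∩ convexHull ℝ (L : Set (Eucl d)) =
      convexHull ℝ ((K : Set (Eucl d)) ∩ L)
  cover : ⋃ K ∈ simplices, convexHull ℝ (K : Set (Eucl d)) = Ω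

namespace Mesh

variable {Ω : Set (Eucl d)} (T : Mesh d Ω)

/-- The set of vertices `𝒱`. -/
def vertices : Finset (Eucl d) :=
  open Classical in T.simplices.biUnion id

/-- The closed simplex with vertex set `K`. -/
def cell (K : T.simplices) : Set (Eucl d) := convexHull ℝ ((K : Finset (Eucl d)) : Set (Eucl d))

/-- The volume `|K|`. -/
def vol (K : T.simplices) : ℝ := volume.real (T.cell K)

/-- The vertices `𝒱_K` of a simplex. -/
def verts (K : T.simplices) : Finset T.vertices :=
  open Classical in Finset.univ.filter fun v => (v : Eucl d) ∈ (K : Finset (Eucl d))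

/-- The simplices `𝒯_v` that have `v` as a vertex. -/
def star (v : T.vertices) : Finset T.simplices :=
  open Classical in Finset.univ.filter fun K => (v : Eucl d) ∈ (K : Finset (Eucl d))

/-- `w` is the family of barycentric coordinates of `x` in the simplex `K`, extended by zero to
points that are not vertices of `K`. -/
def IsBarycentric (K : Finset (Eucl d)) (x : Eucl d) (w : Eucl d → ℝ) : Prop :=
  (∀ y ∈ K, 0 ≤ w y) ∧ ∑ y ∈ K, w y = 1 ∧ ∑ y ∈ K, w y • y = x ∧ ∀ y ∉ K, w y = 0

/-- The nodal basis function of `v`: the continuous function on `Ω`, affine on each simplex, that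
is `1` at `v` and `0` at all other vertices; it is extended by zero outside `Ω`. -/
def hat (v : T.vertices) (x : Eucl d) : ℝ :=
  open Classical in
  if h : ∃ w, ∃ K ∈ T.simplices, IsBarycentric K x w then h.choose v else 0

/-- The definition of `hat` does not depend on the simplex that is used. -/
theorem hat_eq (v : T.vertices) {x : Eucl d} {K : Finset (Eucl d)} (hK : K ∈ T.simplices)
    {w : Eucl d → ℝ} (hw : IsBarycentric K x w) : T.hat v x = w v := by
  classical
  have mem : ∀ {K : Finset (Eucl d)} {w}, IsBarycentric K x w →
      x ∈ convexHull ℝ (K : Set (Eucl d)) := fun {K w} h =>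
    Finset.mem_convexHull'.2 ⟨w, h.1, h.2.1, h.2.2.1⟩
  have uniq : ∀ K ∈ T.simplices, ∀ w w' : Eucl d → ℝ, ∑ y ∈ K, w y = 1 → ∑ y ∈ K, w' y = 1 →
      ∑ y ∈ K, w y • y = ∑ y ∈ K, w' y • y → ∀ y ∈ K, w y = w' y := by
    intro K hK w w' h1 h1' h2 y hy
    have hi := (affineIndependent_iff (k := ℝ) (p := ((↑) : K → Eucl d))).1 (T.indep K hK)
      Finset.univ (fun y => w y - w' y)
      (by rw [Finset.sum_coe_sort K (fun y => w y - w' y), Finset.sum_sub_distrib, h1, h1', sub_self])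
      (by
        rw [Finset.sum_coe_sort K (fun y => (w y - w' y) • y)]
        simp only [sub_smul]
        rw [Finset.sum_sub_distrib, h2, sub_self])
      ⟨y, hy⟩ (Finset.mem_univ _)
    exact sub_eq_zero.1 hi
  have ext : ∀ K ∈ T.simplices, ∀ L ∈ T.simplices, ∀ w w', IsBarycentric K x w →
      IsBarycentric L x w' → ∀ y, w y = w' y := by
    intro K hK L hL w w' h h' y
    have hx : x ∈ convexHull ℝ ((K ∩ L : Finset (Eucl d)) : Set (Eucl d)) := by
      rw [Finset.coe_inter, ← T.conforming K hK L hL]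
      exact ⟨mem h, mem h'⟩
    obtain ⟨u, -, hu1, hu2⟩ := Finset.mem_convexHull'.1 hx
    have key : ∀ M ∈ T.simplices, K ∩ L ⊆ M → ∀ z, IsBarycentric M x z →
        ∀ y, z y = if y ∈ K ∩ L then u y else 0 := by
      intro M hM hsub z hz y
      by_cases hy : y ∈ M
      · refine uniq M hM z (fun y => if y ∈ K ∩ L then u y else 0) hz.2.1 ?_ ?_ y hy
        · rw [← Finset.sum_filter, Finset.filter_mem_eq_inter, Finset.inter_eq_right.2 hsub, hu1]
        · rw [hz.2.2.1]
          simp only [ite_smul, zero_smul]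
          rw [← Finset.sum_filter, Finset.filter_mem_eq_inter, Finset.inter_eq_right.2 hsub, hu2]
      · rw [hz.2.2.2 y hy, if_neg fun h => hy (hsub h)]
    rw [key K hK Finset.inter_subset_left w h, key L hL Finset.inter_subset_right w' h']
  have hex : ∃ w, ∃ K ∈ T.simplices, IsBarycentric K x w := ⟨w, K, hK, hw⟩
  rw [hat, dif_pos hex]
  obtain ⟨L, hL, hLw⟩ := hex.choose_spec
  exact ext L hL K hK _ _ hLw hw _

/-- `|T_v| = ∫ φ_v dx`. -/
def nodeVol (v : T.vertices) : ℝ := ∫ x, T.hat v x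

/-! Discrete spaces: `X̄` consists of the families `T.vertices → Mat n n`, `X` and `X₊` of those
with symmetric resp. positive semidefinite values, `Y` of the families
`T.simplices → Mat n k`. -/

/-- The inner product of `X̄`. -/
def innerV {m : ℕ} (A B : T.vertices → Mat n m) : ℝ := ∑ v, T.nodeVol v * frob (A v) (B v)

/-- The inner product of `Y`. -/
def innerT {m : ℕ} (p q : T.simplices → Mat n m) : ℝ := ∑ K, T.vol K * frob (p K) (q K)

/-- The reconstruction `R ↦ ∑ v, R_v |T_v| δ_v`. -/
def recon {m : ℕ} (R : T.vertices → Mat n m) : VectorMeasure (Eucl d) (Mat n m) :=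
  ∑ v : T.vertices, VectorMeasure.dirac v.1 (T.nodeVol v • R v)

/-- The sampling `(|T_v|⁻¹ ∫ φ_v d𝖦)_v` of a matrix-valued measure. -/
def sample {m : ℕ} (G : VectorMeasure (Eucl d) (Mat n m)) (v : T.vertices) : Mat n m :=
  (T.nodeVol v)⁻¹ • integralScalar G (T.hat v)

/-- The sampling `(|T_v|⁻¹ ∫_Ω Φ φ_v dx)_v` of a matrix-valued function. -/
def sampleFun {m : ℕ} (Φ : Eucl d → Mat n m) (v : T.vertices) : Mat n m :=
  (T.nodeVol v)⁻¹ • Matrix.of fun i j => ∫ x in Ω, Φ x i j * T.hat v x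

/-- The mean over `K` of `𝖣*(S φ_v) = φ_v A₀ S + ∑ j, (∂_j φ_v) A_j S`. -/
def meanDstar (D : DiffOp d n k) (K : T.simplices) (v : T.vertices) (S : SymMat n) : Mat n k :=
  (⨍ x in T.cell K, T.hat v x) • D.zeroth S +
    ∑ j, (⨍ x in T.cell K, fderiv ℝ (T.hat v) x (EuclideanSpace.single j 1)) • D.first j S

/-- The discrete operator `𝖣*_σ`: the mean of `𝖣*(∑ v, G_v φ_v)` over each simplex. -/
def Dstar (D : DiffOp d n k) (G : T.vertices → SymMat n) (K : T.simplices) : Mat n k :=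
  ∑ v ∈ T.verts K, T.meanDstar D K v (G v)

/-- The discrete derivation `𝖣_σ`, the negative adjoint of `𝖣*_σ`. Its entries are read off by
testing with the symmetric parts of the matrix units. -/
def Dsig (D : DiffOp d n k) (q : T.simplices → Mat n k) (v : T.vertices) : Mat n n :=
  Matrix.of fun i j => -(T.nodeVol v)⁻¹ *
    ∑ K ∈ T.star v, T.vol K * frob (q K) (T.meanDstar D K v (toSym (Matrix.single i j 1)))

/-- `𝖣_σ` is the negative adjoint of `𝖣*_σ`. -/
theorem innerV_Dsig (D : DiffOp d n k) (h : ∀ v, T.nodeVol v ≠ 0) (q : T.simplices → Mat n k)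
    (G : T.vertices → SymMat n) :
    T.innerV (fun v => (G v : Mat n n)) (T.Dsig D q) = -T.innerT (T.Dstar D G) q := by
  classical
  have frob_eq : ∀ {a b : ℕ} (A B : Mat a b), frob A B = ∑ i, ∑ j, A i j * B i j := by
    intro a b A B
    simp only [frob, Matrix.trace, Matrix.diag_apply, Matrix.mul_apply, Matrix.transpose_apply]
    exact Finset.sum_comm
  have expand : ∀ S : SymMat n, S = ∑ i, ∑ j, (S : Mat n n) i j • toSym (Matrix.single i j 1) := by
    intro S
    have hS : (S : Mat n n)ᵀ = S := S.2
    apply Subtype.ext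
    simp only [AddSubmonoidClass.coe_finsetSum, Submodule.coe_smul]
    ext a b
    simp only [toSym, symPart, Matrix.sum_apply, Matrix.smul_apply, Matrix.add_apply,
      Matrix.transpose_apply, smul_eq_mul, Matrix.single_apply, mul_add, Finset.sum_add_distrib]
    have hab : (S : Mat n n) b a = (S : Mat n n) a b := by
      conv_lhs => rw [← hS]
      rfl
    simp [ite_and, hab]
    ring
  have lin : ∀ K v, ∃ ℓ : SymMat n →ₗ[ℝ] Mat n k, ∀ S, T.meanDstar D K v S = ℓ S := fun K v =>
    ⟨(⨍ x in T.cell K, T.hat v x) • D.zeroth +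
      ∑ j, (⨍ x in T.cell K, fderiv ℝ (T.hat v) x (EuclideanSpace.single j 1)) • D.first j,
      fun S => by simp [meanDstar, LinearMap.sum_apply]⟩
  have pair : ∀ K v (S : SymMat n), frob (q K) (T.meanDstar D K v S) =
      ∑ i, ∑ j, (S : Mat n n) i j *
        frob (q K) (T.meanDstar D K v (toSym (Matrix.single i j 1))) := by
    intro K v S
    obtain ⟨ℓ, hℓ⟩ := lin K v
    have hfrob : ∀ A B : Mat n k, frob A B = Matrix.traceLinearMap _ ℝ ℝ (Aᵀ * B) := fun _ _ => rfl
    simp only [hℓ, hfrob]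
    conv_lhs => rw [expand S]
    simp only [map_sum, map_smul, Matrix.mul_sum, Matrix.mul_smul, smul_eq_mul]
  have swap : ∀ A B : Mat n k, frob A B = frob B A := by
    intro A B
    simp only [frob_eq, mul_comm]
  have sumr : ∀ (A : Mat n k) (s : Finset T.vertices) (f : T.vertices → Mat n k),
      frob A (∑ v ∈ s, f v) = ∑ v ∈ s, frob A (f v) := by
    intro A s f
    simp only [frob, Matrix.mul_sum, Matrix.trace_sum]
  have rhs : T.innerT (T.Dstar D G) q = ∑ v, ∑ K ∈ T.star v,
      T.vol K * frob (q K) (T.meanDstar D K v (G v)) := by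
    simp only [innerT, Dstar, swap _ (q _), sumr, Finset.mul_sum]
    exact Finset.sum_comm' (by simp [verts, star])
  rw [rhs, innerV, ← Finset.sum_neg_distrib]
  refine Finset.sum_congr rfl fun v _ => ?_
  have hent : ∀ i j, T.Dsig D q v i j = -(T.nodeVol v)⁻¹ * ∑ K ∈ T.star v,
      T.vol K * frob (q K) (T.meanDstar D K v (toSym (Matrix.single i j 1))) := fun _ _ => rfl
  have hK : ∀ K, T.vol K * frob (q K) (T.meanDstar D K v (G v)) = ∑ i, ∑ j, T.vol K *
      ((G v : Mat n n) i j * frob (q K) (T.meanDstar D K v (toSym (Matrix.single i j 1)))) := by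
    intro K
    rw [pair K v (G v)]
    simp only [Finset.mul_sum]
  simp only [hK]
  conv_rhs => rw [Finset.sum_comm, ← Finset.sum_neg_distrib]
  rw [frob_eq, Finset.mul_sum]
  refine Finset.sum_congr rfl fun i _ => ?_
  conv_rhs => rw [Finset.sum_comm, ← Finset.sum_neg_distrib]
  rw [Finset.mul_sum]
  refine Finset.sum_congr rfl fun j _ => ?_
  rw [hent, Finset.mul_sum, Finset.mul_sum, Finset.mul_sum, ← Finset.sum_neg_distrib]
  refine Finset.sum_congr rfl fun K _ => ?_
  have := h v
  field_simp

/-- The discrete action `𝒥_σ(G, q, R)`. -/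
def action (G : T.vertices → Mat n n) (q : T.simplices → Mat n k) (R : T.vertices → Mat n n) :
    ℝ≥0∞ :=
  ∑ K, ENNReal.ofReal (T.vol K) * quadCost ((d + 1 : ℝ)⁻¹ • ∑ v ∈ T.verts K, G v) (q K) +
    ∑ v, ENNReal.ofReal (T.nodeVol v) * quadCost (G v) (R v)

/-- A discrete curve with `N` time steps, of length `τ = 1 / N`: `G` lives at the times
`0, τ, …, Nτ`, and `q`, `R` live at the midpoints. -/
structure Curve (n k N : ℕ) where
  G : Fin (N + 1) → T.vertices → Mat n n
  q : Fin N → T.simplices → Mat n k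
  R : Fin N → T.vertices → Mat n n

/-- The discrete action `𝒥_{τ,σ}` of a curve. -/
def curveAction {N : ℕ} (μ : T.Curve n k N) : ℝ≥0∞ :=
  ENNReal.ofReal (1 / N) * ∑ i : Fin N,
    T.action (fun v => (1 / 2 : ℝ) • (μ.G i.castSucc v + μ.G i.succ v)) (μ.q i) (μ.R i)

/-- The set of solutions of the discrete continuity equation with endpoints `G₀`, `G₁`. -/
def discreteCE (D : DiffOp d n k) (N : ℕ) (G₀ G₁ : T.vertices → Mat n n) :
    Set (T.Curve n k N) :=
  {μ | (∀ i : Fin N, ∀ v, (N : ℝ) • (μ.G i.succ v - μ.G i.castSucc v) =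
        -T.Dsig D (μ.q i) v + symPart (μ.R i v)) ∧
      μ.G 0 = G₀ ∧ μ.G (Fin.last N) = G₁ ∧ ∀ i v, (μ.G i v).PosSemidef}

end Mesh

/-- A quasi-uniform family of conforming triangulations of `Ω`, indexed by the mesh size
`σ = max_K diam K`. -/
structure MeshFamily (d : ℕ) (Ω : Set (Eucl d)) (Sig : Set ℝ) where
  mesh : Sig → Mesh d Ω
  size : ∀ s : Sig, IsGreatest (range fun K => Metric.diam ((mesh s).cell K)) (s : ℝ)
  quasiUniform : ∃ ρ > 0, ∀ s : Sig, ∀ K, ∃ x,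
    Metric.closedBall x (ρ * (s : ℝ)) ⊆ (mesh s).cell K

/-- The filter `σ → 0` on the set of mesh sizes. -/
def toZero (Sig : Set ℝ) : Filter Sig := comap Subtype.val (𝓝 0)

/-! ### Regularization -/

/-- A smooth nonnegative radial function supported in the unit ball, with integral `1`. -/
structure IsMollifier {F : Type*} [NormedAddCommGroup F] [NormedSpace ℝ F] [MeasureSpace F]
    (θ : F → ℝ) : Prop where
  smooth : ContDiff ℝ ∞ θ
  nonneg : ∀ x, 0 ≤ θ x
  radial : ∀ x y, ‖x‖ = ‖y‖ → θ x = θ y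
  supp : tsupport θ ⊆ Metric.closedBall 0 1
  integral_eq : ∫ x, θ x = 1

/-- The objects chosen in the construction of the `ε`-regularization:
* a point `center` in the interior of the set of points with respect to which `Ω` is star-shaped,
  and a Lipschitz constant `L` of the Minkowski functional of `Ω` with respect to `center`;
* a splitting `k = k₁ + (k - k₁)` of the columns in which `𝖣* = (𝖣₀*, 𝖣₁*)`, with `𝖣₀*` of order
  zero and `𝖣₁*` homogeneous of order one;
* a smooth `𝕊ⁿ₊`-valued function `lift`, supported in the closed `1`-neighborhood of `Ω`, with
  `lift ⪰ I` on the closed `1/2`-neighborhood;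
* the kernels in time and in space;
* the set `window ε`, containing the closed `ε`-neighborhood of `Ω`, to which the mollified
  measure is restricted before it is compressed. -/
structure Regularizer (Ω : Set (Eucl d)) (D : DiffOp d n k) where
  center : Eucl d
  center_mem : center ∈ interior {x | x ∈ Ω ∧ StarConvex ℝ x Ω}
  L : ℝ≥0
  lipschitz : LipschitzWith L (gauge ((fun x => x - center) '' Ω))
  k₁ : ℕ
  k₁_le : k₁ ≤ k
  zeroth_split : ∀ S i, ∀ c : Fin k, k₁ ≤ c → D.zeroth S i c = 0
  first_split : ∀ j S i, ∀ c : Fin k, (c : ℕ) < k₁ → D.first j S i c = 0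
  lift : Eucl d → Mat n n
  lift_smooth : ∀ i j, ContDiff ℝ ∞ fun x => lift x i j
  lift_psd : ∀ x, (lift x).PosSemidef
  lift_supp : tsupport lift ⊆ Metric.cthickening 1 Ω
  lift_ge : ∀ x ∈ Metric.cthickening (1 / 2) Ω, (lift x - 1).PosSemidef
  θt : ℝ → ℝ
  θt_moll : IsMollifier θt
  θx : Eucl d → ℝ
  θx_moll : IsMollifier θx
  window : ℝ → Set (Eucl d)
  window_meas : ∀ ε, MeasurableSet (window ε)
  window_sup : ∀ ε, Metric.cthickening ε Ω ⊆ window ε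

namespace Regularizer

variable {Ω : Set (Eucl d)} {D : DiffOp d n k} (reg : Regularizer Ω D)

/-- The scaled kernel in time, `ε⁻¹ θ(t/ε)`. -/
def kerT (ε t : ℝ) : ℝ := ε⁻¹ * reg.θt (ε⁻¹ * t)

/-- The scaled kernel in space, `ε^{-d} θ(x/ε)`. -/
def kerX (ε : ℝ) (x : Eucl d) : ℝ := (ε⁻¹) ^ d * reg.θx (ε⁻¹ • x)

/-- `ρ_ε * μ` at `(t, y)`, for the part of `μ` in the open time interval `(0,1)`. -/
def mollify {m : ℕ} (ε : ℝ) (μ : VectorMeasure (ℝ × Eucl d) (Mat n m)) (t : ℝ) (y : Eucl d) :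
    Mat n m :=
  integralScalar μ ((Ioo 0 1 ×ˢ univ).indicator fun p => reg.kerT ε (t - p.1) * reg.kerX ε (y - p.2))

/-- `ρ_ε * ((1 - ε) 𝖦 + ε Ḡ)` at `(t, y)`, where `𝖦` has been extended in time by `𝖦₀` for
`t ≤ 0` and by `𝖦₁` for `t ≥ 1`. -/
def mollifyG (ε : ℝ) (G₀ G₁ : VectorMeasure (Eucl d) (Mat n n))
    (G : VectorMeasure (ℝ × Eucl d) (Mat n n)) (t : ℝ) (y : Eucl d) : Mat n n :=
  (1 - ε) • (reg.mollify ε G t y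
      + (∫ s in Iic 0, reg.kerT ε (t - s)) • integralScalar G₀ (fun x => reg.kerX ε (y - x))
      + (∫ s in Ici 1, reg.kerT ε (t - s)) • integralScalar G₁ (fun x => reg.kerX ε (y - x)))
    + ε • Matrix.of fun i j =>
        ∫ p : ℝ × Eucl d, reg.kerT ε (t - p.1) * reg.kerX ε (y - p.2) * reg.lift p.2 i j

/-- The inverse `s ↦ (1 + 2ε) s - ε` of the compression `[-ε, 1+ε] → [0,1]` in time. -/
def invT (ε s : ℝ) : ℝ := (1 + 2 * ε) * s - ε

/-- The inverse of the compression `x ↦ c + (1 + L ε)⁻¹ (x - c)` in space. -/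
def invX (ε : ℝ) (x : Eucl d) : Eucl d := reg.center + (1 + reg.L * ε) • (x - reg.center)

/-- The density at `(s, x)` of the push-forward, under the space-time compression, of the measure
with density `f` restricted to the window. -/
def compress {m : ℕ} (ε : ℝ) (f : ℝ → Eucl d → Mat n m) (s : ℝ) (x : Eucl d) : Mat n m :=
  open Classical in
  if reg.invX ε x ∈ reg.window ε then
    (1 + (reg.L : ℝ) * ε) ^ d • f (invT ε s) (reg.invX ε x)
  else 0

/-- The density `G^ε` of the `ε`-regularization. -/
def densG (ε : ℝ) (G₀ G₁ : VectorMeasure (Eucl d) (Mat n n))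
    (μ : TripleMeasure (ℝ × Eucl d) n k) : ℝ → Eucl d → Mat n n :=
  reg.compress ε (reg.mollifyG ε G₀ G₁ μ.G)

/-- The density `q^ε` of the `ε`-regularization: the columns of order one are scaled by
`(1 + L ε)⁻¹`. -/
def densq (ε : ℝ) (μ : TripleMeasure (ℝ × Eucl d) n k) : ℝ → Eucl d → Mat n k :=
  reg.compress ε fun t y => Matrix.of fun i c =>
    (1 + 2 * ε) * (if (c : ℕ) < reg.k₁ then 1 else (1 + (reg.L : ℝ) * ε)⁻¹) *
      ((1 - ε) * reg.mollify ε μ.q t y i c)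

/-- The density `R^ε` of the `ε`-regularization. -/
def densR (ε : ℝ) (μ : TripleMeasure (ℝ × Eucl d) n k) : ℝ → Eucl d → Mat n n :=
  reg.compress ε fun t y => ((1 + 2 * ε) * (1 - ε)) • reg.mollify ε μ.R t y

/-- The `ε`-regularization `μ^ε`, given by its density `(G^ε, q^ε, R^ε)` on `Q`. -/
def regularize (ε : ℝ) (G₀ G₁ : VectorMeasure (Eucl d) (Mat n n))
    (μ : TripleMeasure (ℝ × Eucl d) n k) (s : ℝ) (x : Eucl d) : Mat n n × Mat n k × Mat n n :=
  (reg.densG ε G₀ G₁ μ s x, reg.densq ε μ s x, reg.densR ε μ s x)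

end Regularizer

/-- Assumption A* for the endpoints `𝖦 0`, `𝖦 1`, the discrete endpoints `Gσ 0`, `Gσ 1` and the
`ε`-regularization determined by `reg`: for every `μ ∈ CE_∞` and `i = 0, 1`, there are discrete
curves from `Gσ i` to the sampling of `G^ε_i = G^ε(i, ·)`, for all small `ε > 0`, whose actions
satisfy `limsup_{(τ,σ) → 0} 𝒥_{τ,σ} → 0` as `ε → 0`. -/
def AssumptionAStar {Ω : Set (Eucl d)} {Sig : Set ℝ} (T : MeshFamily d Ω Sig) (D : DiffOp d n k)
    (reg : Regularizer Ω D) (G : Fin 2 → VectorMeasure (Eucl d) (Mat n n))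
    (Gσ : Fin 2 → ∀ s : Sig, (T.mesh s).vertices → Mat n n) : Prop :=
  ∀ μ : TripleMeasure (ℝ × Eucl d) n k, InCEFinite Ω D (G 0) (G 1) μ → ∀ i : Fin 2,
    ∃ c : ℝ → ∀ (N : ℕ) (s : Sig), (T.mesh s).Curve n k N,
      (∀ᶠ ε in 𝓝[>] (0 : ℝ), ∀ N, 0 < N → ∀ s : Sig,
        c ε N s ∈ (T.mesh s).discreteCE D N (Gσ i s)
          ((T.mesh s).sampleFun fun x => (reg.regularize ε (G 0) (G 1) μ ((i : ℕ) : ℝ) x).1)) ∧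
      Tendsto (fun ε => limsup (fun p : ℕ × Sig => (T.mesh p.2).curveAction (c ε p.1 p.2))
        (atTop ×ˢ toZero Sig)) (𝓝[>] 0) (𝓝 0)

end MatrixOT

end

/-! Everything rests on one explicit competitor (`rootCurve`): the square roots of the endpoints are
joined by a straight segment `S_i` at every vertex, and `G_i = S_i²`, `q = 0`. With `C = √G₁ - √G₀`,
the choice `R_i = (S_{i-1} + S_i) C` solves the discrete continuity equation exactly, because `(S +
T)(S - T)` differs from `S² - T²` only by a commutator, which is skew (`symPart_segment`). The
midpoint `(S² + T²)/2` dominates `((S + T)/2)²`, so by Legendre duality each time step costs at most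
`2‖C‖²` per vertex (`quadCost_segment_le`). No differential operator enters, and the bound does not
depend on the time step.

Minimizers come from the direct method. On positive semidefinite matrices the cost is a supremum of
functions continuous in `(X, Y)` (`quadCost_eq_dualCost`), hence lower semicontinuous although the
pseudoinverse is not continuous. A bound on the action controls `q` and `R` by the mass up to an
arbitrarily small factor, and a discrete Gronwall argument then bounds the mass (`exists_bound`). So
sublevel sets are bounded in a finite-dimensional space.

Sampling is the adjoint of nodal interpolation: the reconstructed sample pairs with `Φ` as the
measure pairs with the interpolant of `Φ`, which converges uniformly on `Ω`
(`tendsto_integral_interpolation`).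

For A* the competitor joins the sample of `𝖦_i` to the sample of `G^ε_i`. A Powers–Størmer
inequality (`frob_sub_self_le`) bounds its action by a constant times the weighted `ℓ¹` distance of
the samples. The nodal functions are nonnegative with sum at most one, so this is at most the `L¹`
distance of `𝖦_i` and `G^ε_i`, uniformly in the mesh and the time step (`sum_abs_sample_sub_le`). At
the two endpoints the time kernel sees only the constant extension of `𝖦_i` (`mollifyG_endpoint`),
so `G^ε_i` is, up to terms of order `ε` in `L¹`, a compressed mollification of `𝖦_i`. That converges
in `L¹` (`tendsto_lintegral_smooth_sub`). -/

noncomputable section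

namespace MatrixOT

/-! ### The Frobenius product -/

section Frobenius

variable {n m : ℕ}

theorem frob_eq_sum (A B : Mat n m) : frob A B = ∑ i, ∑ j, A i j * B i j := by
  simp only [frob, Matrix.trace, Matrix.diag_apply, Matrix.mul_apply, Matrix.transpose_apply]
  exact Finset.sum_comm

theorem frob_comm (A B : Mat n m) : frob A B = frob B A := by
  simp only [frob_eq_sum, mul_comm]

theorem frob_add_right (A B C : Mat n m) : frob A (B + C) = frob A B + frob A C := by
  simp [frob, Matrix.mul_add]

theorem frob_sub_left (A B C : Mat n m) : frob (A - B) C = frob A C - frob B C := by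
  simp [frob, Matrix.sub_mul]

theorem frob_sub_right (A B C : Mat n m) : frob A (B - C) = frob A B - frob A C := by
  simp [frob, Matrix.mul_sub]

theorem frob_smul_left (c : ℝ) (A B : Mat n m) : frob (c • A) B = c * frob A B := by
  simp [frob]

theorem frob_smul_right (c : ℝ) (A B : Mat n m) : frob A (c • B) = c * frob A B := by
  simp [frob]

theorem frob_mul_left {l : ℕ} (X : Mat n l) (A : Mat l m) (B : Mat n m) :
    frob (X * A) B = frob A (Xᵀ * B) := by
  simp [frob, Matrix.mul_assoc]

theorem frob_self_nonneg (A : Mat n m) : 0 ≤ frob A A := by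
  rw [frob_eq_sum]
  exact Finset.sum_nonneg fun i _ => Finset.sum_nonneg fun j _ => mul_self_nonneg _

theorem frob_self_eq_zero {A : Mat n m} (h : frob A A = 0) : A = 0 := by
  rw [frob_eq_sum] at h
  have h' := (Finset.sum_eq_zero_iff_of_nonneg fun i _ =>
    Finset.sum_nonneg fun j _ => mul_self_nonneg (A i j)).1 h
  ext i j
  have := (Finset.sum_eq_zero_iff_of_nonneg fun j _ => mul_self_nonneg (A i j)).1
    (h' i (Finset.mem_univ i)) j (Finset.mem_univ j)
  simpa using this

theorem transpose_eq_of_posSemidef {X : Mat n n} (hX : X.PosSemidef) : Xᵀ = X := by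
  simpa using hX.isHermitian.eq

theorem frob_mul_self_nonneg {X : Mat n n} (hX : X.PosSemidef) (Z : Mat n m) :
    0 ≤ frob Z (X * Z) := by
  have h := (hX.conjTranspose_mul_mul_same Z).trace_nonneg
  simpa [frob, Matrix.mul_assoc] using h

theorem frob_mul_swap {X : Mat n n} (hX : Xᵀ = X) (A B : Mat n m) :
    frob A (X * B) = frob B (X * A) := by
  rw [frob_comm A, frob_mul_left, hX]

end Frobenius

/-! ### Spectral calculus -/

section Calculus

variable {n : ℕ}

/-- The spectrum is finite. This opens the continuous functional calculus to `x ↦ x⁻¹`, which is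
discontinuous at zero. -/
theorem continuousOn_spectrum (A : Mat n n) (f : ℝ → ℝ) : ContinuousOn f (spectrum ℝ A) :=
  (Matrix.finite_real_spectrum (A := A)).continuousOn f

theorem isSelfAdjoint_of_transpose {A : Mat n n} (h : Aᵀ = A) : IsSelfAdjoint A := by
  rw [isSelfAdjoint_iff, Matrix.star_eq_conjTranspose, Matrix.conjTranspose_eq_transpose_of_trivial,
    h]

theorem cfc_transpose (A : Mat n n) (f : ℝ → ℝ) : (cfc f A)ᵀ = cfc f A := by
  have h : IsSelfAdjoint (cfc f A) := cfc_predicate f A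
  rwa [isSelfAdjoint_iff, Matrix.star_eq_conjTranspose,
    Matrix.conjTranspose_eq_transpose_of_trivial] at h

theorem pinv_transpose (A : Mat n n) : (pinv A)ᵀ = pinv A := cfc_transpose A _

theorem mul_pinv {A : Mat n n} (h : Aᵀ = A) : A * pinv A = cfc (fun x : ℝ => x * x⁻¹) A := by
  have hA := isSelfAdjoint_of_transpose h
  rw [cfc_mul (fun x : ℝ => x) (fun x => x⁻¹) A (continuousOn_spectrum A _)
    (continuousOn_spectrum A _), cfc_id' ℝ A hA, pinv]

theorem pinv_mul {A : Mat n n} (h : Aᵀ = A) : pinv A * A = A * pinv A := by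
  have := congrArg Matrix.transpose (mul_pinv h)
  rw [cfc_transpose, ← mul_pinv h, Matrix.transpose_mul, pinv_transpose, h] at this
  exact this

theorem mul_pinv_mul {A : Mat n n} (h : Aᵀ = A) : A * pinv A * A = A := by
  have hA := isSelfAdjoint_of_transpose h
  conv_lhs => rw [mul_pinv h]; arg 2; rw [← cfc_id' ℝ A hA]
  rw [← cfc_mul _ _ A (continuousOn_spectrum A _) (continuousOn_spectrum A _)]
  conv_rhs => rw [← cfc_id' ℝ A hA]
  congr 1
  funext x
  -- The convention `0⁻¹ = 0` gives `x x⁻¹ x = x` also on the kernel.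
  by_cases hx : x = 0 <;> simp [hx]

theorem spectrum_nonneg {A : Mat n n} (hA : A.PosSemidef) {x : ℝ} (hx : x ∈ spectrum ℝ A) :
    0 ≤ x := by
  rw [hA.isHermitian.spectrum_real_eq_range_eigenvalues] at hx
  obtain ⟨i, rfl⟩ := hx
  exact hA.eigenvalues_nonneg i

theorem msqrt_mul_self {A : Mat n n} (hA : A.PosSemidef) : msqrt A * msqrt A = A := by
  rw [msqrt, ← cfc_mul _ _ A (continuousOn_spectrum A _) (continuousOn_spectrum A _)]
  conv_rhs => rw [← cfc_id' ℝ A (isSelfAdjoint_of_transpose (transpose_eq_of_posSemidef hA))]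
  exact cfc_congr fun x hx => Real.mul_self_sqrt (spectrum_nonneg hA hx)

theorem msqrt_transpose (A : Mat n n) : (msqrt A)ᵀ = msqrt A := cfc_transpose A _

open scoped MatrixOrder in
theorem msqrt_posSemidef (A : Mat n n) : (msqrt A).PosSemidef := by
  rw [← Matrix.nonneg_iff_posSemidef]
  exact cfc_nonneg fun x _ => Real.sqrt_nonneg x

end Calculus

/-! ### The cost as a supremum -/

section Cost

variable {n m : ℕ}

/-- Each column of `Y` has the form `X u`, and `X X†` fixes such vectors. -/
theorem eq_mul_pinv_of_range_le {X : Mat n n} (hX : Xᵀ = X) {Y : Mat n m}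
    (h : LinearMap.range Y.mulVecLin ≤ LinearMap.range X.mulVecLin) : Y = X * (pinv X * Y) := by
  refine Matrix.ext_of_mulVec_single fun j => ?_
  obtain ⟨u, hu⟩ := h ⟨Pi.single j 1, rfl⟩
  simp only [Matrix.mulVecLin_apply] at hu
  rw [← Matrix.mulVec_mulVec, ← Matrix.mulVec_mulVec, ← hu, Matrix.mulVec_mulVec,
    Matrix.mulVec_mulVec, mul_pinv_mul hX]

/-- Fenchel inequality by completing the square: with `Y = X W`, the difference of the two sides is
half the quadratic form of `X` at `W - Z`. -/
theorem le_quadCost {X : Mat n n} (hX : X.PosSemidef) (Y Z : Mat n m) :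
    ENNReal.ofReal (frob Y Z - 1 / 2 * frob Z (X * Z)) ≤ quadCost X Y := by
  have hs := transpose_eq_of_posSemidef hX
  unfold quadCost
  split_ifs with h
  · apply ENNReal.ofReal_le_ofReal
    set W := pinv X * Y with hW
    have hY : Y = X * W := eq_mul_pinv_of_range_le hs h.2
    have h0 := frob_mul_self_nonneg hX (W - Z)
    have h1 := frob_mul_swap hs Z W
    rw [Matrix.mul_sub, frob_sub_left, frob_sub_right, frob_sub_right, h1] at h0
    have e1 : frob Y Z = frob W (X * Z) := by rw [hY, frob_mul_left, hs]
    have e2 : frob Y W = frob W (X * W) := by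
      conv_lhs => rw [hY]
      rw [frob_mul_left, hs]
    rw [e1, e2]
    linarith
  · exact le_top

/-- The converse of `le_quadCost`. A finite bound over all `Z` forces `Ran Y ⊆ Ran X`, after which
`Z = X† Y` attains the cost. -/
theorem quadCost_le {X : Mat n n} (hX : X.PosSemidef) {Y : Mat n m} {c : ℝ}
    (h : ∀ Z, frob Y Z - 1 / 2 * frob Z (X * Z) ≤ c) : quadCost X Y ≤ ENNReal.ofReal c := by
  have hs := transpose_eq_of_posSemidef hX
  -- The part of `Y` orthogonal to `Ran X`. Along multiples of `V` the quadratic term vanishes and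
  -- the functional is linear with slope `‖V‖²`.
  set V := Y - X * pinv X * Y with hV
  have hXV : pinv X * X * V = 0 := by
    have : pinv X * X * (X * pinv X) = pinv X * X := by
      rw [← pinv_mul hs, Matrix.mul_assoc, ← Matrix.mul_assoc X, mul_pinv_mul hs]
    rw [hV, Matrix.mul_sub, ← Matrix.mul_assoc, this, sub_self]
  have hXV' : X * V = 0 := by
    rw [← mul_pinv_mul hs, Matrix.mul_assoc, Matrix.mul_assoc, ← Matrix.mul_assoc (pinv X), hXV,
      Matrix.mul_zero]
  have hYV : frob Y V = frob V V := by
    have : frob (X * pinv X * Y) V = 0 := by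
      rw [frob_mul_left, Matrix.transpose_mul, pinv_transpose, hs, hXV]
      simp [frob]
    conv_rhs => rw [hV, frob_sub_left, ← hV, this, sub_zero]
  have hV0 : V = 0 := by
    apply frob_self_eq_zero
    by_contra hne
    have hpos : 0 < frob V V := lt_of_le_of_ne (frob_self_nonneg V) (Ne.symm hne)
    -- The multiple is chosen so that the functional takes the value `c + 1`.
    have := h (((c + 1) / frob V V) • V)
    rw [Matrix.mul_smul, hXV', frob_smul_right, hYV] at this
    have h0 : frob (((c + 1) / frob V V) • V) (((c + 1) / frob V V) • (0 : Mat n m)) = 0 := by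
      simp [frob]
    rw [h0, div_mul_cancel₀ _ hne] at this
    linarith
  have hY : Y = X * (pinv X * Y) := by
    rw [← Matrix.mul_assoc]
    exact sub_eq_zero.1 hV0
  have hr : LinearMap.range Y.mulVecLin ≤ LinearMap.range X.mulVecLin := by
    rintro _ ⟨u, rfl⟩
    refine ⟨(pinv X * Y).mulVec u, ?_⟩
    simp only [Matrix.mulVecLin_apply, Matrix.mulVec_mulVec]
    rw [← hY]
  rw [quadCost, if_pos ⟨hX, hr⟩]
  apply ENNReal.ofReal_le_ofReal
  have := h (pinv X * Y)
  rw [← hY, frob_comm _ Y] at this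
  linarith

theorem quadCost_zero {X : Mat n n} (hX : X.PosSemidef) : quadCost X (0 : Mat n m) = 0 := by
  refine le_antisymm ((quadCost_le hX (c := 0) fun Z => ?_).trans_eq (by simp)) bot_le
  have := frob_mul_self_nonneg hX Z
  have h0 : frob (0 : Mat n m) Z = 0 := by simp [frob]
  rw [h0]
  linarith

/-- The Legendre representation of the cost, which is defined for all `X`. -/
def dualCost (X : Mat n n) (Y : Mat n m) : ℝ≥0∞ :=
  ⨆ Z : Mat n m, ENNReal.ofReal (frob Y Z - 1 / 2 * frob Z (X * Z))

theorem quadCost_eq_dualCost {X : Mat n n} (hX : X.PosSemidef) (Y : Mat n m) :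
    quadCost X Y = dualCost X Y := by
  refine le_antisymm ?_ (iSup_le fun Z => le_quadCost hX Y Z)
  by_cases ht : dualCost X Y = ⊤
  · rw [ht]
    exact le_top
  · rw [← ENNReal.ofReal_toReal ht]
    refine quadCost_le hX fun Z => ?_
    rw [← ENNReal.ofReal_le_iff_le_toReal ht]
    exact le_iSup (fun Z : Mat n m => ENNReal.ofReal (frob Y Z - 1 / 2 * frob Z (X * Z))) Z

/-- Testing the Legendre form with `±s` times a matrix unit gives this Young-type bound. The free
parameter `s` later makes the coefficient of the trace small. -/
theorem abs_entry_le_of_quadCost_le {X : Mat n n} (hX : X.PosSemidef) {Y : Mat n m} {c : ℝ}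
    (hc : 0 ≤ c) (h : quadCost X Y ≤ ENNReal.ofReal c) (i : Fin n) (j : Fin m) {s : ℝ}
    (hs : 0 < s) : |Y i j| ≤ c / s + s / 2 * X.trace := by
  have hdiag : X i i ≤ X.trace :=
    Finset.single_le_sum (f := fun i => X i i) (fun a _ => hX.diag_nonneg) (Finset.mem_univ i)
  have key : ∀ r : ℝ, r * Y i j - 1 / 2 * r ^ 2 * X i i ≤ c := by
    intro r
    have := (le_quadCost hX Y (Matrix.single i j r)).trans h
    rw [ENNReal.ofReal_le_ofReal_iff hc] at this
    have e1 : frob Y (Matrix.single i j r) = r * Y i j := by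
      rw [frob_eq_sum, Finset.sum_eq_single i, Finset.sum_eq_single j]
      · simp [mul_comm]
      · intro b _ hb
        simp [hb.symm]
      · simp
      · intro b _ hb
        simp [hb.symm]
      · simp
    have e2 : frob (Matrix.single i j r) (X * Matrix.single i j r) = r ^ 2 * X i i := by
      rw [frob_comm, frob_eq_sum, Finset.sum_eq_single i, Finset.sum_eq_single j]
      · simp
        ring
      · intro b _ hb
        simp [hb.symm]
      · simp
      · intro b _ hb
        simp [hb.symm]
      · simp
    rw [e1, e2] at this
    linarith
  have h1 := key s
  have h2 := key (-s)
  have h3 : s * |Y i j| ≤ c + s ^ 2 / 2 * X.trace := by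
    have : s ^ 2 * X i i ≤ s ^ 2 * X.trace := by gcongr
    rcases abs_cases (Y i j) with ⟨e, _⟩ | ⟨e, _⟩ <;> rw [e] <;> nlinarith
  have h4 : c / s + s / 2 * X.trace = (c + s ^ 2 / 2 * X.trace) / s := by
    field_simp
  rw [h4, le_div_iff₀ hs]
  linarith

theorem abs_entry_le_trace {X : Mat n n} (hX : X.PosSemidef) (a b : Fin n) :
    |X a b| ≤ X.trace := by
  have hd : ∀ i, X i i ≤ X.trace := fun i =>
    Finset.single_le_sum (f := fun i => X i i) (fun a _ => hX.diag_nonneg) (Finset.mem_univ i)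
  have hsym : X b a = X a b := by
    conv_lhs => rw [← transpose_eq_of_posSemidef hX]
    rfl
  -- Quadratic form at `e_a + r e_b`; the two signs of `r` bound `2 |X a b|` by two diagonal
  -- entries.
  have key : ∀ r : ℝ, r ^ 2 = 1 → 0 ≤ X a a + 2 * r * X a b + X b b := by
    intro r hr
    have := hX.dotProduct_mulVec_nonneg (Pi.single a 1 + Pi.single b r)
    simp [add_dotProduct, Matrix.mulVec_add, dotProduct_add] at this
    rw [hsym] at this
    linear_combination this + X b b * hr
  have h1 := key 1 (by norm_num)
  have h2 := key (-1) (by norm_num)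
  have := hd a
  have := hd b
  rw [abs_le]
  constructor <;> linarith

end Cost

/-! ### Square roots -/

section SquareRoot

variable {n : ℕ}

theorem posSemidef_mul_self {S : Mat n n} (hS : Sᵀ = S) : (S * S).PosSemidef := by
  have := Matrix.posSemidef_conjTranspose_mul_self S
  rwa [Matrix.conjTranspose_eq_transpose_of_trivial, hS] at this

/-- The action of the segment between two square roots, over one time step. -/
theorem quadCost_segment_le {S T C : Mat n n} (hS : Sᵀ = S) (hT : Tᵀ = T) :
    quadCost ((1 / 2 : ℝ) • (S * S + T * T)) ((S + T) * C) ≤ ENNReal.ofReal (2 * frob C C) := by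
  apply quadCost_le (((posSemidef_mul_self hS).add (posSemidef_mul_self hT)).smul (by norm_num))
  intro Z
  -- Parallelogram identity. The mean of the squares is the square of the mean plus `(S - T)²/4`,
  -- and the latter only lowers the functional to be bounded.
  have e1 : (1 / 2 : ℝ) • (S * S + T * T) * Z =
      (1 / 4 : ℝ) • ((S + T) * ((S + T) * Z)) + (1 / 4 : ℝ) • ((S - T) * ((S - T) * Z)) := by
    simp only [← Matrix.mul_assoc, Matrix.smul_mul]
    rw [← smul_add, ← Matrix.add_mul]
    have : (S + T) * (S + T) + (S - T) * (S - T) = (2 : ℝ) • (S * S + T * T) := by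
      rw [two_smul]
      noncomm_ring
    rw [this, Matrix.smul_mul, smul_smul]
    norm_num
  have hST : (S + T)ᵀ = S + T := by rw [Matrix.transpose_add, hS, hT]
  have hST' : (S - T)ᵀ = S - T := by rw [Matrix.transpose_sub, hS, hT]
  have e2 : frob Z ((S + T) * ((S + T) * Z)) = frob ((S + T) * Z) ((S + T) * Z) := by
    rw [frob_mul_left, hST]
  have e3 : frob Z ((S - T) * ((S - T) * Z)) = frob ((S - T) * Z) ((S - T) * Z) := by
    rw [frob_mul_left, hST']
  rw [e1, frob_add_right, frob_smul_right, frob_smul_right, e2, e3, frob_mul_left, hST]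
  have h0 := frob_self_nonneg ((S - T) * Z)
  -- With `W = (S + T) Z`, half of this square is `2‖C‖² - C · W + ‖W‖²/8`, exactly the remaining
  -- gap.
  have h1 := frob_self_nonneg ((2 : ℝ) • C - (1 / 2 : ℝ) • ((S + T) * Z))
  simp only [frob_sub_left, frob_sub_right, frob_smul_left, frob_smul_right] at h1
  rw [frob_comm ((S + T) * Z) C] at h1
  nlinarith

/-- The cross terms form the commutator `TS - ST`, which is skew for symmetric `S`, `T`. This is an
exact discrete product rule. -/
theorem symPart_segment {S T : Mat n n} (hS : Sᵀ = S) (hT : Tᵀ = T) :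
    symPart ((S + T) * (S - T)) = S * S - T * T := by
  rw [symPart, Matrix.transpose_mul, Matrix.transpose_sub, Matrix.transpose_add, hS, hT]
  have : (S + T) * (S - T) + (S - T) * (S + T) = (2 : ℝ) • (S * S - T * T) := by
    rw [two_smul]
    noncomm_ring
  rw [this, smul_smul]
  norm_num

/-- Since `S² - T² = S(S - T) + (S - T)T`, its quadratic form at an eigenvector of `S - T` is `r`
times the sum of `⟨v, Sv⟩` and `⟨v, Tv⟩`. Their difference is `r`, and both are nonnegative, so the
sum is at least `|r|`. -/
theorem sq_eigenvalue_le {S T : Mat n n} (hS : S.PosSemidef) (hT : T.PosSemidef) {v : Fin n → ℝ}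
    {r : ℝ} (hv : (S - T) *ᵥ v = r • v) (h1 : v ⬝ᵥ v = 1) :
    r ^ 2 ≤ |v ⬝ᵥ ((S * S - T * T) *ᵥ v)| := by
  have hs := transpose_eq_of_posSemidef hS
  have ht := transpose_eq_of_posSemidef hT
  have hst : (S - T)ᵀ = S - T := by rw [Matrix.transpose_sub, hs, ht]
  have e : S * S - T * T = S * (S - T) + (S - T) * T := by noncomm_ring
  have e1 : v ⬝ᵥ ((S * S - T * T) *ᵥ v) = r * (v ⬝ᵥ (S *ᵥ v) + v ⬝ᵥ (T *ᵥ v)) := by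
    rw [e, Matrix.add_mulVec, dotProduct_add, ← Matrix.mulVec_mulVec, hv, Matrix.mulVec_smul,
      dotProduct_smul, ← Matrix.mulVec_mulVec, Matrix.dotProduct_mulVec v (S - T),
      ← Matrix.mulVec_transpose, hst, hv, smul_dotProduct]
    simp only [smul_eq_mul]
    ring
  have e2 : r = v ⬝ᵥ (S *ᵥ v) - v ⬝ᵥ (T *ᵥ v) := by
    rw [← dotProduct_sub, ← Matrix.sub_mulVec, hv, dotProduct_smul, h1]
    simp
  have p1 : 0 ≤ v ⬝ᵥ (S *ᵥ v) := by simpa using hS.dotProduct_mulVec_nonneg v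
  have p2 : 0 ≤ v ⬝ᵥ (T *ᵥ v) := by simpa using hT.dotProduct_mulVec_nonneg v
  rw [e1, abs_mul, abs_of_nonneg (add_nonneg p1 p2), ← sq_abs, sq]
  apply mul_le_mul_of_nonneg_left _ (abs_nonneg r)
  rw [e2, abs_le]
  constructor <;> linarith

theorem frob_self_eq_sum_eigenvalues {A : Mat n n} (hA : A.IsHermitian) :
    frob A A = ∑ i, hA.eigenvalues i ^ 2 := by
  have h := hA.spectral_theorem
  have h2 : frob A A = (A * A).trace := by
    rw [frob, ← Matrix.conjTranspose_eq_transpose_of_trivial, hA.eq]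
  set D : Mat n n := Matrix.diagonal (RCLike.ofReal ∘ hA.eigenvalues) with hD
  have h3 : A * A = Unitary.conjStarAlgAut ℝ _ hA.eigenvectorUnitary (D * D) := by
    rw [map_mul, ← h]
  rw [h2, h3, Unitary.conjStarAlgAut_apply, Matrix.trace_mul_comm, ← Matrix.mul_assoc]
  simp [hD, Matrix.trace, pow_two]

/-- The Powers–Størmer inequality, with a constant that depends on the dimension. -/
theorem frob_sub_self_le {S T : Mat n n} (hS : S.PosSemidef) (hT : T.PosSemidef) :
    frob (S - T) (S - T) ≤ n * ∑ a, ∑ b, |(S * S - T * T) a b| := by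
  have hh : (S - T).IsHermitian := hS.isHermitian.sub hT.isHermitian
  rw [frob_self_eq_sum_eigenvalues hh]
  have key : ∀ i, hh.eigenvalues i ^ 2 ≤ ∑ a, ∑ b, |(S * S - T * T) a b| := by
    intro i
    set v : Fin n → ℝ := ⇑(hh.eigenvectorBasis i) with hv
    have h1 : v ⬝ᵥ v = 1 := by
      have : ‖hh.eigenvectorBasis i‖ ^ 2 = 1 := by
        rw [hh.eigenvectorBasis.norm_eq_one]
        norm_num
      rw [EuclideanSpace.norm_sq_eq] at this
      rw [← this]
      simp [dotProduct, pow_two, hv]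
    -- Components of a unit vector are at most one, so the quadratic form is bounded by the sum of
    -- the absolute entries.
    have hle : ∀ a, |v a| ≤ 1 := by
      intro a
      rw [← sq_le_one_iff_abs_le_one, ← h1, dotProduct]
      refine (pow_two (v a)).le.trans ?_
      exact Finset.single_le_sum (f := fun a => v a * v a) (fun _ _ => mul_self_nonneg _)
        (Finset.mem_univ a)
    refine (sq_eigenvalue_le hS hT (hh.mulVec_eigenvectorBasis i) h1).trans ?_
    rw [dotProduct]
    refine (Finset.abs_sum_le_sum_abs _ _).trans (Finset.sum_le_sum fun a _ => ?_)
    rw [abs_mul, Matrix.mulVec, dotProduct]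
    refine (mul_le_of_le_one_left (abs_nonneg _) (hle a)).trans ?_
    refine (Finset.abs_sum_le_sum_abs _ _).trans (Finset.sum_le_sum fun b _ => ?_)
    rw [abs_mul]
    exact mul_le_of_le_one_right (abs_nonneg _) (hle b)
  calc ∑ i, hh.eigenvalues i ^ 2 ≤ ∑ _i : Fin n, ∑ a, ∑ b, |(S * S - T * T) a b| :=
        Finset.sum_le_sum fun i _ => key i
    _ = n * ∑ a, ∑ b, |(S * S - T * T) a b| := by simp

end SquareRoot

/-! ### Nodal basis functions -/

namespace Mesh

variable {d : ℕ} {Ω : Set (Eucl d)} (T : Mesh d Ω)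

theorem exists_isBarycentric {K : Finset (Eucl d)} {x : Eucl d}
    (hx : x ∈ convexHull ℝ (K : Set (Eucl d))) : ∃ w, IsBarycentric K x w := by
  classical
  obtain ⟨w, h0, h1, h2⟩ := Finset.mem_convexHull'.1 hx
  refine ⟨fun y => if y ∈ K then w y else 0, fun y hy => ?_, ?_, ?_, fun y hy => if_neg hy⟩
  · exact (h0 y hy).trans_eq (if_pos hy).symm
  · rw [← h1]
    exact Finset.sum_congr rfl fun y hy => if_pos hy
  · rw [← h2]
    exact Finset.sum_congr rfl fun y hy => congrArg (· • y) (if_pos hy)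

theorem exists_mem_cell {x : Eucl d} (hx : x ∈ Ω) : ∃ K : T.simplices, x ∈ T.cell K := by
  rw [← T.cover] at hx
  simp only [mem_iUnion] at hx
  obtain ⟨K, hK, hx⟩ := hx
  exact ⟨⟨K, hK⟩, hx⟩

theorem cell_subset (K : T.simplices) : T.cell K ⊆ Ω := by
  intro x hx
  rw [← T.cover]
  simp only [mem_iUnion]
  exact ⟨K, K.2, hx⟩

theorem isClosed_cell (K : T.simplices) : IsClosed (T.cell K) :=
  (K : Finset (Eucl d)).finite_toSet.isCompact_convexHull ℝ |>.isClosed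

theorem isBounded_cell (K : T.simplices) : Bornology.IsBounded (T.cell K) :=
  ((K : Finset (Eucl d)).finite_toSet.isCompact_convexHull ℝ).isBounded

theorem mem_vertices {K : Finset (Eucl d)} (hK : K ∈ T.simplices) {y : Eucl d} (hy : y ∈ K) :
    y ∈ T.vertices := by
  classical
  exact Finset.mem_biUnion.2 ⟨K, hK, hy⟩

theorem exists_simplex (v : T.vertices) : ∃ K : T.simplices, (v : Eucl d) ∈ (K : Finset (Eucl d)) := by
  classical
  obtain ⟨K, hK, hv⟩ := Finset.mem_biUnion.1 (show _ ∈ T.simplices.biUnion id from v.2)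
  exact ⟨⟨K, hK⟩, hv⟩

/-- The affine basis formed by the vertices of a simplex. -/
def affineBasis (K : T.simplices) : AffineBasis (K : Finset (Eucl d)) ℝ (Eucl d) where
  toFun := (↑)
  ind' := T.indep K K.2
  tot' := by
    rw [(T.indep K K.2).affineSpan_eq_top_iff_card_eq_finrank_add_one]
    simp [T.card_eq K K.2]

theorem range_affineBasis (K : T.simplices) :
    range (T.affineBasis K) = ((K : Finset (Eucl d)) : Set (Eucl d)) :=
  Subtype.range_coe

theorem interior_cell (K : T.simplices) :
    interior (T.cell K) = {x | ∀ y, 0 < (T.affineBasis K).coord y x} := by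
  rw [cell, ← T.range_affineBasis K, AffineBasis.interior_convexHull]

theorem interior_cell_nonempty (K : T.simplices) : (interior (T.cell K)).Nonempty := by
  rw [cell, ← T.range_affineBasis K]
  exact ⟨_, (T.affineBasis K).centroid_mem_interior_convexHull⟩

theorem hat_eq_coord (K : T.simplices) {x : Eucl d} (hx : x ∈ T.cell K) (v : T.vertices)
    (hv : (v : Eucl d) ∈ (K : Finset (Eucl d))) :
    T.hat v x = (T.affineBasis K).coord ⟨v, hv⟩ x := by
  obtain ⟨w, hw⟩ := exists_isBarycentric hx
  rw [T.hat_eq v K.2 hw]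
  have h1 : ∑ y : (K : Finset (Eucl d)), w y = 1 := by
    rw [← hw.2.1]
    exact Finset.sum_coe_sort (K : Finset (Eucl d)) w
  have h2 : Finset.univ.affineCombination ℝ (T.affineBasis K) (fun y => w y) = x := by
    rw [Finset.affineCombination_eq_linear_combination _ _ _ h1]
    rw [← hw.2.2.1]
    exact Finset.sum_coe_sort (K : Finset (Eucl d)) fun y => w y • y
  rw [← h2, AffineBasis.coord_apply_combination_of_mem _ (Finset.mem_univ _) h1]

theorem hat_eq_zero_of_notMem_simplex (K : T.simplices) {x : Eucl d} (hx : x ∈ T.cell K)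
    (v : T.vertices) (hv : (v : Eucl d) ∉ (K : Finset (Eucl d))) : T.hat v x = 0 := by
  obtain ⟨w, hw⟩ := exists_isBarycentric hx
  rw [T.hat_eq v K.2 hw, hw.2.2.2 _ hv]

theorem hat_eq_zero_of_notMem {x : Eucl d} (hx : x ∉ Ω) (v : T.vertices) : T.hat v x = 0 := by
  rw [hat, dif_neg]
  rintro ⟨w, K, hK, hw⟩
  exact hx (T.cell_subset ⟨K, hK⟩ (Finset.mem_convexHull'.2 ⟨w, hw.1, hw.2.1, hw.2.2.1⟩))

theorem exists_continuous_eqOn_cell (K : T.simplices) (v : T.vertices) :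
    ∃ g : Eucl d → ℝ, Continuous g ∧ EqOn (T.hat v) g (T.cell K) := by
  by_cases hv : (v : Eucl d) ∈ (K : Finset (Eucl d))
  · exact ⟨(T.affineBasis K).coord ⟨v, hv⟩, ((T.affineBasis K).coord ⟨v, hv⟩).continuous_of_finiteDimensional,
      fun x hx => T.hat_eq_coord K hx v hv⟩
  · exact ⟨fun _ => 0, continuous_const, fun x hx => T.hat_eq_zero_of_notMem_simplex K hx v hv⟩

theorem isClosed_domain (T : Mesh d Ω) : IsClosed Ω := by
  have h : Ω = ⋃ K : T.simplices, T.cell K := by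
    ext x
    simp only [mem_iUnion]
    exact ⟨T.exists_mem_cell, fun ⟨K, hK⟩ => T.cell_subset K hK⟩
  rw [h]
  exact isClosed_iUnion_of_finite T.isClosed_cell

/-- The extension by zero may jump across the boundary of `Ω`, so continuity is not available.
Preimages are glued instead from the complement of `Ω` and the finitely many closed cells, on each
of which the function agrees with a continuous one. -/
theorem measurable_hat (v : T.vertices) : Measurable (T.hat v) := by
  intro s hs
  choose g hg hgeq using fun K => T.exists_continuous_eqOn_cell K v
  have : T.hat v ⁻¹' s = (Ωᶜ ∩ (fun _ => (0 : ℝ)) ⁻¹' s) ∪ ⋃ K, T.cell K ∩ g K ⁻¹' s := by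
    ext x
    simp only [mem_union, mem_inter_iff, mem_iUnion, mem_preimage, mem_compl_iff]
    constructor
    · intro h
      by_cases hx : x ∈ Ω
      · obtain ⟨K, hK⟩ := T.exists_mem_cell hx
        exact Or.inr ⟨K, hK, by rwa [← hgeq K hK]⟩
      · exact Or.inl ⟨hx, by rwa [T.hat_eq_zero_of_notMem hx] at h⟩
    · rintro (⟨hx, h⟩ | ⟨K, hK, h⟩)
      · rwa [T.hat_eq_zero_of_notMem hx]
      · rwa [hgeq K hK]
  rw [this]
  exact (T.isClosed_domain.measurableSet.compl.inter (measurable_const hs)).union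
    (MeasurableSet.iUnion fun K => (T.isClosed_cell K).measurableSet.inter ((hg K).measurable hs))

theorem hat_nonneg (v : T.vertices) (x : Eucl d) : 0 ≤ T.hat v x := by
  by_cases hx : x ∈ Ω
  · obtain ⟨K, hK⟩ := T.exists_mem_cell hx
    obtain ⟨w, hw⟩ := exists_isBarycentric hK
    rw [T.hat_eq v K.2 hw]
    by_cases hv : (v : Eucl d) ∈ (K : Finset (Eucl d))
    · exact hw.1 _ hv
    · exact (hw.2.2.2 _ hv).ge
  · exact (T.hat_eq_zero_of_notMem hx v).ge

theorem sum_hat {x : Eucl d} (hx : x ∈ Ω) : ∑ v, T.hat v x = 1 := by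
  obtain ⟨K, hK⟩ := T.exists_mem_cell hx
  obtain ⟨w, hw⟩ := exists_isBarycentric hK
  have h1 : ∑ v, T.hat v x = ∑ v : T.vertices, w v :=
    Finset.sum_congr rfl fun v _ => T.hat_eq v K.2 hw
  rw [h1, Finset.sum_coe_sort T.vertices w, ← hw.2.1]
  exact (Finset.sum_subset (fun y hy => T.mem_vertices K.2 hy) fun y _ hy => hw.2.2.2 y hy).symm

theorem sum_hat_le (x : Eucl d) : ∑ v, T.hat v x ≤ 1 := by
  by_cases hx : x ∈ Ω
  · exact (T.sum_hat hx).le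
  · simp [T.hat_eq_zero_of_notMem hx]

theorem hat_le_one (v : T.vertices) (x : Eucl d) : T.hat v x ≤ 1 :=
  (Finset.single_le_sum (f := fun v => T.hat v x) (fun v _ => T.hat_nonneg v x)
    (Finset.mem_univ v)).trans (T.sum_hat_le x)

theorem norm_hat_le (v : T.vertices) (x : Eucl d) : ‖T.hat v x‖ ≤ 1 := by
  rw [Real.norm_of_nonneg (T.hat_nonneg v x)]
  exact T.hat_le_one v x

/-- Any cell containing such an `x` must have `v` as a vertex. This localizes the interpolation
error at the mesh size. -/
theorem dist_le_of_hat_ne_zero {v : T.vertices} {x : Eucl d} (h : T.hat v x ≠ 0) :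
    ∃ K, dist x v ≤ Metric.diam (T.cell K) := by
  have hx : x ∈ Ω := by
    by_contra hx
    exact h (T.hat_eq_zero_of_notMem hx v)
  obtain ⟨K, hK⟩ := T.exists_mem_cell hx
  have hv : (v : Eucl d) ∈ (K : Finset (Eucl d)) := by
    by_contra hv
    exact h (T.hat_eq_zero_of_notMem_simplex K hK v hv)
  exact ⟨K, Metric.dist_le_diam_of_mem (T.isBounded_cell K) hK (subset_convexHull ℝ _ hv)⟩

theorem vertex_mem (v : T.vertices) : (v : Eucl d) ∈ Ω := by
  obtain ⟨K, hK⟩ := T.exists_simplex v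
  exact T.cell_subset K (subset_convexHull ℝ _ hK)

theorem vol_pos (K : T.simplices) : 0 < T.vol K := by
  rw [vol, measureReal_def, ENNReal.toReal_pos_iff]
  exact ⟨(isOpen_interior.measure_pos volume (T.interior_cell_nonempty K)).trans_le
    (measure_mono interior_subset),
    (T.isBounded_cell K).measure_lt_top⟩

theorem integrable_hat (hΩ : IsCompact Ω) (v : T.vertices) : Integrable (T.hat v) := by
  have h : IntegrableOn (T.hat v) Ω := by
    refine Measure.integrableOn_of_bounded (M := 1) hΩ.measure_lt_top.ne
      (T.measurable_hat v).aestronglyMeasurable ?_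
    exact Eventually.of_forall fun x => T.norm_hat_le v x
  rwa [integrableOn_iff_integrable_of_support_subset] at h
  intro x hx
  by_contra hx'
  exact hx (T.hat_eq_zero_of_notMem hx' v)

/-- In the interior of a simplex with vertex `v` the nodal function is a barycentric coordinate,
hence positive there. -/
theorem nodeVol_pos (hΩ : IsCompact Ω) (v : T.vertices) : 0 < T.nodeVol v := by
  rw [nodeVol, integral_pos_iff_support_of_nonneg (T.hat_nonneg v) (T.integrable_hat hΩ v)]
  obtain ⟨K, hK⟩ := T.exists_simplex v
  refine (isOpen_interior.measure_pos volume (T.interior_cell_nonempty K)).trans_le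
    (measure_mono fun x hx => ?_)
  rw [Function.mem_support, T.hat_eq_coord K (interior_subset hx) v hK]
  rw [T.interior_cell K] at hx
  exact (hx _).ne'

end Mesh

/-! ### Integrals with respect to signed and matrix-valued measures -/

section SignedIntegral

variable {α : Type*} [MeasurableSpace α]

theorem isFiniteMeasure_variation (s : SignedMeasure α) : IsFiniteMeasure s.variation := by
  rw [← s.totalVariation_eq_variation]
  infer_instance

theorem integrable_variation_of_bounded (s : SignedMeasure α) {f : α → ℝ} (hf : Measurable f)
    {C : ℝ} (hC : ∀ x, ‖f x‖ ≤ C) : Integrable f s.variation :=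
  have := isFiniteMeasure_variation s
  Integrable.of_bound hf.aestronglyMeasurable C (Eventually.of_forall hC)

theorem integral_lsmul_toSignedMeasure (μ : Measure α) [IsFiniteMeasure μ] (f : α → ℝ) :
    μ.toSignedMeasure.integral f (ContinuousLinearMap.lsmul ℝ ℝ) = ∫ x, f x ∂μ := by
  have h : (ContinuousLinearMap.lsmul ℝ ℝ : ℝ →L[ℝ] ℝ →L[ℝ] ℝ) =
      (ContinuousLinearMap.lsmul ℝ ℝ : ℝ →L[ℝ] ℝ →L[ℝ] ℝ).flip := by
    ext
    simp
  rw [h, VectorMeasure.integral_toSignedMeasure]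

theorem integral_lsmul_nonneg {s : SignedMeasure α} (hs : ∀ B, MeasurableSet B → 0 ≤ s B)
    {f : α → ℝ} (hf : ∀ x, 0 ≤ f x) : 0 ≤ s.integral f (ContinuousLinearMap.lsmul ℝ ℝ) := by
  have h0 : 0 ≤[Set.univ] s := by
    rw [VectorMeasure.restrict_le_restrict_iff _ _ MeasurableSet.univ]
    intro B hB _
    exact hs B hB
  rw [← s.toMeasureOfZeroLE_toSignedMeasure h0, integral_lsmul_toSignedMeasure]
  exact integral_nonneg hf

/-- Splitting `g` into positive and negative parts reduces the claim to positive measures with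
density. -/
theorem integral_lsmul_withDensity {μ : Measure α} {g : α → ℝ} (hgm : Measurable g)
    (hg : Integrable g μ) {f : α → ℝ} (hf : Measurable f) {C : ℝ} (hC : ∀ x, ‖f x‖ ≤ C) :
    (μ.withDensityᵥ g).integral f (ContinuousLinearMap.lsmul ℝ ℝ) = ∫ x, f x * g x ∂μ := by
  have h1 := isFiniteMeasure_withDensity_ofReal hg.2
  have h2 := isFiniteMeasure_withDensity_ofReal hg.neg.2
  simp only [Pi.neg_apply] at h2
  have hint : ∀ (ν : Measure α) [IsFiniteMeasure ν], Integrable f ν.toSignedMeasure.variation :=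
    fun ν _ => integrable_variation_of_bounded _ hf hC
  rw [withDensityᵥ_eq_withDensity_pos_part_sub_withDensity_neg_part hg,
    VectorMeasure.integral_sub_vectorMeasure (hint _) (hint _), integral_lsmul_toSignedMeasure,
    integral_lsmul_toSignedMeasure,
    integral_withDensity_eq_integral_toReal_smul hgm.ennreal_ofReal
      (Eventually.of_forall fun x => ENNReal.ofReal_lt_top),
    integral_withDensity_eq_integral_toReal_smul (g := f) (f := fun x => ENNReal.ofReal (-g x)) hgm.neg.ennreal_ofReal
      (Eventually.of_forall fun x => ENNReal.ofReal_lt_top), ← integral_sub]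
  · refine integral_congr_ae (Eventually.of_forall fun x => ?_)
    simp only [smul_eq_mul, ENNReal.toReal_ofReal']
    rw [← sub_mul, max_zero_sub_max_neg_zero_eq_self, mul_comm]
  · refine (hg.pos_part.bdd_mul (c := C) hf.aestronglyMeasurable
      (Eventually.of_forall hC)).congr (Eventually.of_forall fun x => ?_)
    simp only [smul_eq_mul, ENNReal.toReal_ofReal', mul_comm]
  · refine (hg.neg_part.bdd_mul (c := C) hf.aestronglyMeasurable
      (Eventually.of_forall hC)).congr (Eventually.of_forall fun x => ?_)
    simp only [smul_eq_mul, ENNReal.toReal_ofReal', mul_comm]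

theorem sum_vectorMeasure_apply {ι M : Type*} [AddCommMonoid M] [TopologicalSpace M]
    [ContinuousAdd M] (t : Finset ι) (μ : ι → VectorMeasure α M) (B : Set α) :
    (∑ i ∈ t, μ i) B = ∑ i ∈ t, μ i B := by
  classical
  induction t using Finset.induction_on with
  | empty => simp
  | insert a t ha ih => rw [Finset.sum_insert ha, Finset.sum_insert ha, add_apply, ih]

variable {n m : ℕ}

theorem entry_apply (μ : VectorMeasure α (Mat n m)) (i : Fin n) (j : Fin m) (B : Set α) :
    entry μ i j B = μ B i j := rfl

theorem variation_entry_compl {S : Set α} (hS : MeasurableSet S) {μ : VectorMeasure α (Mat n m)}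
    (h : ConcentratedOn S μ) (i : Fin n) (j : Fin m) : (entry μ i j).variation Sᶜ = 0 := by
  rw [VectorMeasure.variation_apply_eq_zero hS.compl]
  intro t ht htm
  rw [entry_apply, h t htm (disjoint_left.2 fun x hx => ht hx), Matrix.zero_apply]

/-- The quadratic form of the integral at `x` is the integral of `f` against the scalar measure `B ↦
x · μ(B) x`, which is nonnegative. -/
theorem integralScalar_posSemidef {μ : VectorMeasure α (Mat n n)}
    (hμ : ∀ B, MeasurableSet B → (μ B).PosSemidef) {f : α → ℝ} (hf : Measurable f)
    (h0 : ∀ x, 0 ≤ f x) {C : ℝ} (hC : ∀ x, ‖f x‖ ≤ C) : (integralScalar μ f).PosSemidef := by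
  have hsymm : ∀ i j, entry μ i j = entry μ j i := by
    intro i j
    ext B hB
    rw [entry_apply, entry_apply]
    conv_lhs => rw [← transpose_eq_of_posSemidef (hμ B hB)]
    rfl
  refine Matrix.PosSemidef.of_dotProduct_mulVec_nonneg ?_ fun x => ?_
  · ext i j
    simp [integralScalar, hsymm i j]
  · have hint : ∀ i j, Integrable f (entry μ i j).variation := fun i j =>
      integrable_variation_of_bounded _ hf hC
    have hint' : ∀ i j, (x i • x j • entry μ i j).Integrable f := fun i j =>
      integrable_variation_of_bounded _ hf hC
    set s : SignedMeasure α := ∑ i, ∑ j, x i • x j • entry μ i j with hs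
    have e : star x ⬝ᵥ integralScalar μ f *ᵥ x =
        s.integral f (ContinuousLinearMap.lsmul ℝ ℝ) := by
      rw [hs, VectorMeasure.integral_finsetSum_vectorMeasure fun i _ =>
        VectorMeasure.Integrable.finsetSum_vectorMeasure fun j _ => hint' i j]
      simp only [dotProduct, Matrix.mulVec, star_trivial, Finset.mul_sum]
      refine Finset.sum_congr rfl fun i _ => ?_
      rw [VectorMeasure.integral_finsetSum_vectorMeasure fun j _ => hint' i j]
      refine Finset.sum_congr rfl fun j _ => ?_
      rw [VectorMeasure.integral_smul_vectorMeasure, VectorMeasure.integral_smul_vectorMeasure]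
      simp only [integralScalar, Matrix.of_apply, smul_eq_mul]
      ring
    rw [e]
    refine integral_lsmul_nonneg (fun B hB => ?_) h0
    have := (hμ B hB).dotProduct_mulVec_nonneg x
    refine this.trans_eq ?_
    simp only [hs, sum_vectorMeasure_apply, smul_apply, dotProduct, Matrix.mulVec, star_trivial,
      Finset.mul_sum, entry_apply, smul_eq_mul]
    refine Finset.sum_congr rfl fun i _ => Finset.sum_congr rfl fun j _ => ?_
    ring

end SignedIntegral

/-! ### Sampling -/

namespace Mesh

variable {d n m : ℕ} {Ω : Set (Eucl d)} (T : Mesh d Ω)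

theorem sample_posSemidef (hΩ : IsCompact Ω) {G : VectorMeasure (Eucl d) (Mat n n)}
    (hG : ∀ B, MeasurableSet B → (G B).PosSemidef) (v : T.vertices) :
    (T.sample G v).PosSemidef :=
  (integralScalar_posSemidef hG (T.measurable_hat v) (T.hat_nonneg v) (T.norm_hat_le v)).smul
    (inv_nonneg.2 (T.nodeVol_pos hΩ v).le)

theorem pairing_recon (R : T.vertices → Mat n m) (Φ : Eucl d → Mat n m) :
    pairing (T.recon R) Φ = ∑ i, ∑ j, ∑ v, T.nodeVol v * R v i j * Φ v i j := by
  have he : ∀ i j, entry (T.recon R) i j =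
      ∑ v : T.vertices, VectorMeasure.dirac v.1 (T.nodeVol v * R v i j) := by
    intro i j
    ext B hB
    rw [entry_apply, recon, sum_vectorMeasure_apply, sum_vectorMeasure_apply, Matrix.sum_apply]
    refine Finset.sum_congr rfl fun v _ => ?_
    by_cases hv : (v : Eucl d) ∈ B <;> simp [hB, hv]
  refine Finset.sum_congr rfl fun i _ => Finset.sum_congr rfl fun j _ => ?_
  rw [he, VectorMeasure.integral_finsetSum_vectorMeasure]
  · refine Finset.sum_congr rfl fun v _ => ?_
    rw [VectorMeasure.integral_dirac]
    simp [mul_comm]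
  · intro v _
    rw [VectorMeasure.Integrable, VectorMeasure.variation_dirac]
    exact (integrable_dirac (by simp)).smul_measure enorm_ne_top

/-- The weights `nodeVol` of reconstruction and sampling cancel; what remains is the integral of the
nodal interpolant. -/
theorem pairing_recon_sample (hΩ : IsCompact Ω) (G : VectorMeasure (Eucl d) (Mat n m))
    (Φ : Eucl d → Mat n m) : pairing (T.recon (T.sample G)) Φ = ∑ i, ∑ j,
      (entry G i j).integral (fun x => ∑ v, T.hat v x * Φ v i j)
        (ContinuousLinearMap.lsmul ℝ ℝ) := by
  rw [pairing_recon]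
  refine Finset.sum_congr rfl fun i _ => Finset.sum_congr rfl fun j _ => ?_
  rw [VectorMeasure.integral_finsetSum]
  · refine Finset.sum_congr rfl fun v _ => ?_
    have e : (fun x => T.hat v x * Φ v i j) = fun x => Φ v i j • T.hat v x := by
      funext x
      rw [smul_eq_mul, mul_comm]
    rw [e, VectorMeasure.integral_fun_smul]
    have := (T.nodeVol_pos hΩ v).ne'
    simp only [sample, integralScalar, Matrix.smul_apply, Matrix.of_apply, smul_eq_mul]
    field_simp
  · intro v _
    exact (integrable_variation_of_bounded _ (T.measurable_hat v) (T.norm_hat_le v)).mul_const _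

end Mesh

/-- The nodal functions are a partition of unity on `Ω`, supported at distance at most `σ` from
their vertices. The interpolation error is thus a modulus of continuity of `φ` at scale `σ`, and the
total variation is finite. -/
theorem tendsto_integral_interpolation {d : ℕ} {Ω : Set (Eucl d)} (hΩ : IsCompact Ω)
    {Sig : Set ℝ} (T : MeshFamily d Ω Sig)
    {s : SignedMeasure (Eucl d)} (hs : s.variation Ωᶜ = 0) {φ : Eucl d → ℝ}
    (hφ : ContinuousOn φ Ω) :
    Tendsto (fun σ : Sig => s.integral (fun x => ∑ v, (T.mesh σ).hat v x * φ v)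
      (ContinuousLinearMap.lsmul ℝ ℝ)) (toZero Sig)
      (𝓝 (s.integral φ (ContinuousLinearMap.lsmul ℝ ℝ))) := by
  have := isFiniteMeasure_variation s
  have hΩm := hΩ.isClosed.measurableSet
  have hae : ∀ᵐ x ∂s.variation, x ∈ Ω := by
    rw [ae_iff]
    exact hs
  have hrestr : s.variation.restrict Ω = s.variation := Measure.restrict_eq_self_of_ae_mem hae
  have hφi : Integrable φ s.variation := by
    rw [← hrestr]
    exact hφ.integrableOn_compact hΩ
  have hii : ∀ σ : Sig, Integrable (fun x => ∑ v, (T.mesh σ).hat v x * φ v) s.variation :=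
    fun σ => integrable_finsetSum _ fun v _ => (integrable_variation_of_bounded _
      ((T.mesh σ).measurable_hat v) ((T.mesh σ).norm_hat_le v)).mul_const _
  have huc := hΩ.uniformContinuousOn_of_continuous hφ
  rw [Metric.uniformContinuousOn_iff] at huc
  rw [Metric.tendsto_nhds]
  intro ε hε
  set V := s.variation.real univ with hV
  have hV0 : 0 ≤ V := measureReal_nonneg
  -- `V + 1` rather than `V` covers zero variation, and the factor `2` gives a strict inequality.
  obtain ⟨δ, hδ, hδ'⟩ := huc (ε / (2 * (V + 1))) (by positivity)
  have hev : ∀ᶠ σ : Sig in toZero Sig, (σ : ℝ) < δ :=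
    (eventually_lt_nhds hδ).comap _
  filter_upwards [hev] with σ hσ
  have hle : ∀ᵐ x ∂s.variation, ‖∑ v, (T.mesh σ).hat v x * φ v - φ x‖ ≤ ε / (2 * (V + 1)) := by
    filter_upwards [hae] with x hx
    have e : ∑ v, (T.mesh σ).hat v x * φ v - φ x =
        ∑ v, (T.mesh σ).hat v x * (φ v - φ x) := by
      simp only [mul_sub, Finset.sum_sub_distrib, ← Finset.sum_mul, (T.mesh σ).sum_hat hx, one_mul]
    rw [e]
    calc ‖∑ v, (T.mesh σ).hat v x * (φ v - φ x)‖
        ≤ ∑ v, (T.mesh σ).hat v x * (ε / (2 * (V + 1))) := by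
          refine norm_sum_le_of_le _ fun v _ => ?_
          rw [norm_mul, Real.norm_of_nonneg ((T.mesh σ).hat_nonneg v x)]
          by_cases h0 : (T.mesh σ).hat v x = 0
          · simp [h0]
          · refine mul_le_mul_of_nonneg_left ?_ ((T.mesh σ).hat_nonneg v x)
            obtain ⟨K, hK⟩ := (T.mesh σ).dist_le_of_hat_ne_zero h0
            have hK' := (T.size σ).2 ⟨K, rfl⟩
            refine (hδ' v ((T.mesh σ).vertex_mem v) x hx ?_).le
            rw [dist_comm]
            exact (hK.trans hK').trans_lt hσ
      _ = ε / (2 * (V + 1)) := by rw [← Finset.sum_mul, (T.mesh σ).sum_hat hx, one_mul]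
  rw [dist_eq_norm, ← VectorMeasure.integral_fun_sub (hii σ) hφi]
  have hB : ‖(ContinuousLinearMap.lsmul ℝ ℝ : ℝ →L[ℝ] ℝ →L[ℝ] ℝ)‖ ≤ 1 :=
    ContinuousLinearMap.opNorm_lsmul_le
  calc _ ≤ ε / (2 * (V + 1)) * ‖(ContinuousLinearMap.lsmul ℝ ℝ : ℝ →L[ℝ] ℝ →L[ℝ] ℝ)‖ * V :=
        VectorMeasure.norm_integral_le_of_norm_le_const hle
    _ ≤ ε / (2 * (V + 1)) * 1 * (V + 1) := by gcongr; linarith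
    _ = ε / 2 := by field_simp
    _ < ε := by linarith

theorem tendsto_pairing_recon_sample {d n : ℕ} {Ω : Set (Eucl d)} (hΩ : IsCompact Ω)
    {Sig : Set ℝ} (T : MeshFamily d Ω Sig)
    {G : VectorMeasure (Eucl d) (Mat n n)} (hG : ConcentratedOn Ω G) {Φ : Eucl d → SymMat n}
    (hΦ : ContinuousOn Φ Ω) :
    Tendsto (fun s : Sig =>
      pairing ((T.mesh s).recon ((T.mesh s).sample G)) fun x => (Φ x : Mat n n))
      (toZero Sig) (𝓝 (pairing G fun x => (Φ x : Mat n n))) := by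
  have e (s : Sig) : pairing ((T.mesh s).recon ((T.mesh s).sample G)) (fun x => (Φ x : Mat n n)) =
      ∑ i, ∑ j, (entry G i j).integral (fun x => ∑ v, (T.mesh s).hat v x * (Φ v : Mat n n) i j)
        (ContinuousLinearMap.lsmul ℝ ℝ) :=
    (T.mesh s).pairing_recon_sample hΩ G fun x => (Φ x : Mat n n)
  rw [tendsto_congr e]
  refine tendsto_finsetSum _ fun i _ => tendsto_finsetSum _ fun j _ => ?_
  have hc : ContinuousOn (fun x => (Φ x : Mat n n) i j) Ω :=
    ((continuous_id.matrix_elem i j).comp continuous_subtype_val).comp_continuousOn hΦ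
  exact tendsto_integral_interpolation (s := entry G i j)
    (φ := fun x => (Φ x : Mat n n) i j) hΩ T
    (variation_entry_compl (μ := G) hΩ.isClosed.measurableSet hG i j) hc

/-! ### Discrete curves -/

namespace Mesh

variable {d n k : ℕ} {Ω : Set (Eucl d)} (T : Mesh d Ω)

theorem Dsig_zero (D : DiffOp d n k) (v : T.vertices) :
    T.Dsig D (fun _ => (0 : Mat n k)) v = 0 := by
  ext i j
  simp [Dsig, frob]

/-- The segment between the square roots. -/
def rootSegment (N : ℕ) (G₀ G₁ : T.vertices → Mat n n) (t : ℕ) (v : T.vertices) : Mat n n :=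
  msqrt (G₀ v) + ((t : ℝ) / N) • (msqrt (G₁ v) - msqrt (G₀ v))

/-- The discrete curve of the squares of the segment between the square roots. -/
def rootCurve (k N : ℕ) (G₀ G₁ : T.vertices → Mat n n) : T.Curve n k N where
  G i v := T.rootSegment N G₀ G₁ i v * T.rootSegment N G₀ G₁ i v
  q _ _ := 0
  R i v := (T.rootSegment N G₀ G₁ i v + T.rootSegment N G₀ G₁ (i + 1) v) *
    (msqrt (G₁ v) - msqrt (G₀ v))

theorem rootSegment_transpose (N : ℕ) (G₀ G₁ : T.vertices → Mat n n) (t : ℕ) (v : T.vertices) :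
    (T.rootSegment N G₀ G₁ t v)ᵀ = T.rootSegment N G₀ G₁ t v := by
  simp [rootSegment, msqrt_transpose]

/-- The field `R` need not be symmetric, but the equation sees only its symmetric part, to which
`symPart_segment` applies. -/
theorem rootCurve_mem (D : DiffOp d n k) {N : ℕ} (hN : 0 < N) {G₀ G₁ : T.vertices → Mat n n}
    (h₀ : ∀ v, (G₀ v).PosSemidef) (h₁ : ∀ v, (G₁ v).PosSemidef) :
    T.rootCurve k N G₀ G₁ ∈ T.discreteCE D N G₀ G₁ := by
  have hN' : (N : ℝ) ≠ 0 := by positivity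
  refine ⟨fun i v => ?_, ?_, ?_, fun i v => posSemidef_mul_self (T.rootSegment_transpose _ _ _ _ _)⟩
  -- The increments of the segment are constant, so the total increment is `N` times the current
  -- one.
  · have hC : msqrt (G₁ v) - msqrt (G₀ v) =
        (N : ℝ) • (T.rootSegment N G₀ G₁ (i + 1) v - T.rootSegment N G₀ G₁ i v) := by
      simp only [rootSegment]
      rw [add_sub_add_left_eq_sub, ← sub_smul, smul_smul]
      push_cast
      rw [show (N : ℝ) * (((i : ℕ) + 1) / N - (i : ℕ) / N) = 1 by field_simp; ring, one_smul]
    have hsymm : ∀ A : Mat n n, symPart ((N : ℝ) • A) = (N : ℝ) • symPart A := by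
      intro A
      simp only [symPart, Matrix.transpose_smul, ← smul_add]
      rw [smul_comm]
    simp only [rootCurve, Dsig_zero, neg_zero, zero_add, Fin.val_castSucc, Fin.val_succ]
    rw [hC, Matrix.mul_smul, hsymm, add_comm (T.rootSegment N G₀ G₁ i v),
      symPart_segment (T.rootSegment_transpose _ _ _ _ _) (T.rootSegment_transpose _ _ _ _ _)]
  · funext v
    simp [rootCurve, rootSegment, msqrt_mul_self (h₀ v)]
  · funext v
    simp [rootCurve, rootSegment, hN', msqrt_mul_self (h₁ v)]

theorem posSemidef_midpoint {A B : Mat n n} (hA : A.PosSemidef) (hB : B.PosSemidef) :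
    ((1 / 2 : ℝ) • (A + B)).PosSemidef :=
  (hA.add hB).smul (by norm_num)

theorem posSemidef_mean (K : T.simplices) {G : T.vertices → Mat n n} (h : ∀ v, (G v).PosSemidef) :
    ((d + 1 : ℝ)⁻¹ • ∑ v ∈ T.verts K, G v).PosSemidef :=
  (Matrix.posSemidef_sum _ fun v _ => h v).smul (by positivity)

/-- All steps obey the same bound, so averaging over the `N` steps leaves it unchanged. The simplex
terms vanish since `q = 0` and the averaged matrices are positive semidefinite. -/
theorem curveAction_rootCurve_le (hΩ : IsCompact Ω) {N : ℕ} (hN : 0 < N)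
    (G₀ G₁ : T.vertices → Mat n n) : T.curveAction (T.rootCurve k N G₀ G₁) ≤
      ENNReal.ofReal (2 * ∑ v, T.nodeVol v *
          frob (msqrt (G₁ v) - msqrt (G₀ v)) (msqrt (G₁ v) - msqrt (G₀ v))) := by
  set c := 2 * ∑ v, T.nodeVol v *
          frob (msqrt (G₁ v) - msqrt (G₀ v)) (msqrt (G₁ v) - msqrt (G₀ v)) with hc
  have hN' : (0 : ℝ) < N := by positivity
  have key : ∀ i : Fin N, T.action (fun v => (1 / 2 : ℝ) • ((T.rootCurve k N G₀ G₁).G i.castSucc v +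
      (T.rootCurve k N G₀ G₁).G i.succ v)) ((T.rootCurve k N G₀ G₁).q i)
      ((T.rootCurve k N G₀ G₁).R i) ≤ ENNReal.ofReal c := by
    intro i
    have hpsd : ∀ i v, ((T.rootCurve k N G₀ G₁).G i v).PosSemidef := fun i v =>
      posSemidef_mul_self (T.rootSegment_transpose _ _ _ _ _)
    rw [action, Finset.sum_eq_zero, zero_add]
    · rw [hc, Finset.mul_sum, ENNReal.ofReal_sum_of_nonneg fun v _ => mul_nonneg (by norm_num)
        (mul_nonneg (T.nodeVol_pos hΩ v).le (frob_self_nonneg _))]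
      refine Finset.sum_le_sum fun v _ => ?_
      rw [mul_left_comm, ENNReal.ofReal_mul (T.nodeVol_pos hΩ v).le]
      gcongr
      exact quadCost_segment_le (T.rootSegment_transpose _ _ _ _ _)
        (T.rootSegment_transpose _ _ _ _ _)
    · intro K _
      rw [show (T.rootCurve k N G₀ G₁).q i K = 0 from rfl, quadCost_zero, mul_zero]
      exact T.posSemidef_mean K fun v => posSemidef_midpoint (hpsd _ v) (hpsd _ v)
  calc T.curveAction (T.rootCurve k N G₀ G₁)
      ≤ ENNReal.ofReal (1 / N) * ∑ _i : Fin N, ENNReal.ofReal c := by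
        rw [curveAction]
        gcongr with i
        exact key i
    _ = ENNReal.ofReal c := by
        rw [Finset.sum_const, Finset.card_univ, Fintype.card_fin, nsmul_eq_mul, ← mul_assoc,
          ← ENNReal.ofReal_natCast, ← ENNReal.ofReal_mul (by positivity)]
        rw [one_div, inv_mul_cancel₀ hN'.ne', ENNReal.ofReal_one, one_mul]

/-! ### Bounds in terms of the action -/

/-- A linear map between finite-dimensional spaces is bounded. The constant may depend on the mesh,
which suffices for existence of minimizers on a fixed mesh. -/
theorem exists_abs_Dsig_le (D : DiffOp d n k) : ∃ A, 0 ≤ A ∧ ∀ (q : T.simplices → Mat n k) (B : ℝ),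
    0 ≤ B → (∀ K i j, |q K i j| ≤ B) → ∀ v a b, |T.Dsig D q v a b| ≤ A * B := by
  set F : T.vertices → Fin n → Fin n → ℝ := fun v a b => |(T.nodeVol v)⁻¹| *
    ∑ K ∈ T.star v, |T.vol K| *
      ∑ i, ∑ j, |T.meanDstar D K v (toSym (Matrix.single a b 1)) i j| with hF
  have hF0 : ∀ v a b, 0 ≤ F v a b := fun v a b => mul_nonneg (abs_nonneg _)
    (Finset.sum_nonneg fun K _ => mul_nonneg (abs_nonneg _)
      (Finset.sum_nonneg fun i _ => Finset.sum_nonneg fun j _ => abs_nonneg _))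
  refine ⟨∑ v, ∑ a, ∑ b, F v a b, Finset.sum_nonneg fun v _ => Finset.sum_nonneg fun a _ =>
    Finset.sum_nonneg fun b _ => hF0 v a b, fun q B hB0 hB v a b => ?_⟩
  have h1 : |T.Dsig D q v a b| ≤ F v a b * B := by
    rw [Dsig, Matrix.of_apply, abs_mul, abs_neg, hF, mul_assoc, Finset.sum_mul]
    refine mul_le_mul_of_nonneg_left ?_ (abs_nonneg _)
    refine (Finset.abs_sum_le_sum_abs _ _).trans (Finset.sum_le_sum fun K _ => ?_)
    rw [abs_mul, mul_assoc, Finset.sum_mul, frob_eq_sum]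
    refine mul_le_mul_of_nonneg_left ?_ (abs_nonneg _)
    refine (Finset.abs_sum_le_sum_abs _ _).trans (Finset.sum_le_sum fun i _ => ?_)
    rw [Finset.sum_mul]
    refine (Finset.abs_sum_le_sum_abs _ _).trans (Finset.sum_le_sum fun j _ => ?_)
    rw [abs_mul, mul_comm]
    exact mul_le_mul_of_nonneg_left (hB K i j) (abs_nonneg _)
  have h2 : F v a b ≤ ∑ v, ∑ a, ∑ b, F v a b :=
    ((Finset.single_le_sum (f := fun b => F v a b) (fun b _ => hF0 v a b)
      (Finset.mem_univ b)).trans (Finset.single_le_sum (f := fun a => ∑ b, F v a b)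
      (fun a _ => Finset.sum_nonneg fun b _ => hF0 v a b) (Finset.mem_univ a))).trans
      (Finset.single_le_sum (f := fun v => ∑ a, ∑ b, F v a b)
      (fun v _ => Finset.sum_nonneg fun a _ => Finset.sum_nonneg fun b _ => hF0 v a b)
      (Finset.mem_univ v))
  exact h1.trans (mul_le_mul_of_nonneg_right h2 hB0)

theorem exists_pos_forall_le {ι : Type*} [Finite ι] {f : ι → ℝ} (hf : ∀ i, 0 < f i) :
    ∃ w > 0, ∀ i, w ≤ f i := by
  cases isEmpty_or_nonempty ι
  · exact ⟨1, one_pos, isEmptyElim⟩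
  · obtain ⟨i, hi⟩ := Finite.exists_min f
    exact ⟨f i, hf i, hi⟩

theorem exists_pos_le_vol (hΩ : IsCompact Ω) :
    ∃ w > 0, (∀ K, w ≤ T.vol K) ∧ ∀ v, w ≤ T.nodeVol v := by
  obtain ⟨a, ha, ha'⟩ := exists_pos_forall_le (f := T.vol) T.vol_pos
  obtain ⟨b, hb, hb'⟩ := exists_pos_forall_le (f := T.nodeVol) (T.nodeVol_pos hΩ)
  exact ⟨min a b, lt_min ha hb, fun K => (min_le_left _ _).trans (ha' K),
    fun v => (min_le_right _ _).trans (hb' v)⟩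

end Mesh

theorem le_ofReal_div_of_mul_le {w u c : ℝ} (hw : 0 < w) (hu : w ≤ u) {x : ℝ≥0∞}
    (h : ENNReal.ofReal u * x ≤ ENNReal.ofReal c) : x ≤ ENNReal.ofReal (c / w) := by
  rw [ENNReal.ofReal_div_of_pos hw, ENNReal.le_div_iff_mul_le (Or.inl (by simpa using hw))
    (Or.inl ENNReal.ofReal_ne_top), mul_comm]
  exact (mul_le_mul_left (ENNReal.ofReal_le_ofReal hu) x).trans h

theorem symPart_apply {n : ℕ} (A : Mat n n) (a b : Fin n) :
    symPart A a b = 1 / 2 * (A a b + A b a) := rfl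

namespace Mesh

variable {d n k : ℕ} {Ω : Set (Eucl d)} (T : Mesh d Ω)

theorem action_le_of_curveAction_le {N : ℕ} (hN : 0 < N) {μ : T.Curve n k N} {B : ℝ}
    (h : T.curveAction μ ≤ ENNReal.ofReal B) (i : Fin N) :
    T.action (fun v => (1 / 2 : ℝ) • (μ.G i.castSucc v + μ.G i.succ v)) (μ.q i) (μ.R i) ≤
      ENNReal.ofReal (N * B) := by
  have hN' : (0 : ℝ) < 1 / N := by positivity
  rw [curveAction] at h
  set a : Fin N → ℝ≥0∞ := fun i => T.action (fun v => (1 / 2 : ℝ) •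
    (μ.G i.castSucc v + μ.G i.succ v)) (μ.q i) (μ.R i) with ha
  have := le_ofReal_div_of_mul_le hN' le_rfl h
  rw [div_div_eq_mul_div, div_one, mul_comm B] at this
  exact (Finset.single_le_sum (f := a) (fun _ _ => bot_le) (Finset.mem_univ i)).trans this

/-- The total trace of a discrete field. -/
def mass (G : T.vertices → Mat n n) : ℝ := ∑ v, (G v).trace

theorem trace_le_mass {G : T.vertices → Mat n n} (hG : ∀ v, (G v).PosSemidef) (v : T.vertices) :
    (G v).trace ≤ T.mass G :=
  Finset.single_le_sum (f := fun v => (G v).trace) (fun v _ => (hG v).trace_nonneg)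
    (Finset.mem_univ v)

theorem mass_nonneg {G : T.vertices → Mat n n} (hG : ∀ v, (G v).PosSemidef) : 0 ≤ T.mass G :=
  Finset.sum_nonneg fun v _ => (hG v).trace_nonneg

theorem trace_mean_le_mass (K : T.simplices) {G : T.vertices → Mat n n}
    (hG : ∀ v, (G v).PosSemidef) :
    ((d + 1 : ℝ)⁻¹ • ∑ v ∈ T.verts K, G v).trace ≤ T.mass G := by
  rw [Matrix.trace_smul, Matrix.trace_sum, smul_eq_mul]
  have h0 : 0 ≤ ∑ v ∈ T.verts K, (G v).trace := Finset.sum_nonneg fun v _ => (hG v).trace_nonneg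
  refine (mul_le_of_le_one_left h0 (inv_le_one_of_one_le₀ (by simp))).trans ?_
  exact Finset.sum_le_sum_of_subset_of_nonneg (Finset.subset_univ _)
    fun v _ _ => (hG v).trace_nonneg

/-- The sizes of `q` and `R` are controlled by the action and the mass. -/
theorem abs_entry_le_of_action_le {w : ℝ} (hw : 0 < w) (hK : ∀ K, w ≤ T.vol K)
    (hv : ∀ v, w ≤ T.nodeVol v) {G : T.vertices → Mat n n} (hG : ∀ v, (G v).PosSemidef)
    {q : T.simplices → Mat n k} {R : T.vertices → Mat n n} {B : ℝ} (hB : 0 ≤ B)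
    (h : T.action G q R ≤ ENNReal.ofReal B) {s : ℝ} (hs : 0 < s) :
    (∀ K i j, |q K i j| ≤ B / w / s + s / 2 * T.mass G) ∧
      ∀ v i j, |R v i j| ≤ B / w / s + s / 2 * T.mass G := by
  have hBw : 0 ≤ B / w := by positivity
  constructor
  · intro K i j
    have h1 : ENNReal.ofReal (T.vol K) * quadCost ((d + 1 : ℝ)⁻¹ • ∑ v ∈ T.verts K, G v) (q K) ≤
        ENNReal.ofReal B :=
      (Finset.single_le_sum (f := fun K => ENNReal.ofReal (T.vol K) *
        quadCost ((d + 1 : ℝ)⁻¹ • ∑ v ∈ T.verts K, G v) (q K)) (fun _ _ => bot_le)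
        (Finset.mem_univ K)).trans ((le_add_right le_rfl).trans h)
    refine (abs_entry_le_of_quadCost_le (T.posSemidef_mean K hG) hBw
      (le_ofReal_div_of_mul_le hw (hK K) h1) i j hs).trans ?_
    gcongr
    exact T.trace_mean_le_mass K hG
  · intro v i j
    have h1 : ENNReal.ofReal (T.nodeVol v) * quadCost (G v) (R v) ≤ ENNReal.ofReal B :=
      (Finset.single_le_sum (f := fun v => ENNReal.ofReal (T.nodeVol v) * quadCost (G v) (R v))
        (fun _ _ => bot_le) (Finset.mem_univ v)).trans ((le_add_left le_rfl).trans h)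
    refine (abs_entry_le_of_quadCost_le (hG v) hBw
      (le_ofReal_div_of_mul_le hw (hv v) h1) i j hs).trans ?_
    gcongr
    exact T.trace_le_mass hG v

theorem mass_midpoint (G H : T.vertices → Mat n n) :
    T.mass (fun v => (1 / 2 : ℝ) • (G v + H v)) = 1 / 2 * (T.mass G + T.mass H) := by
  simp only [mass, Matrix.trace_smul, Matrix.trace_add, smul_eq_mul, ← Finset.mul_sum,
    Finset.sum_add_distrib]

/-- Curves with bounded action and fixed endpoints are bounded. -/
theorem exists_bound (hΩ : IsCompact Ω) (D : DiffOp d n k) {N : ℕ} (hN : 0 < N)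
    (G₀ G₁ : T.vertices → Mat n n) {B : ℝ} (hB : 0 ≤ B) :
    ∃ C, ∀ μ ∈ T.discreteCE D N G₀ G₁, T.curveAction μ ≤ ENNReal.ofReal B →
      (∀ i v a b, |μ.G i v a b| ≤ C) ∧ (∀ i K a b, |μ.q i K a b| ≤ C) ∧
      ∀ i v a b, |μ.R i v a b| ≤ C := by
  obtain ⟨w, hw, hwK, hwv⟩ := T.exists_pos_le_vol hΩ
  obtain ⟨A₁, hA₁, hA₁'⟩ := T.exists_abs_Dsig_le D
  -- The change of mass sums `n` diagonal entries at each vertex; each is bounded through `A₁` for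
  -- `Dsig` and `1` for the reaction term.
  set A : ℝ := Fintype.card T.vertices * (n * (A₁ + 1)) with hA
  have hA0 : 0 ≤ A := by positivity
  have hN1 : (1 : ℝ) ≤ N := by exact_mod_cast hN
  -- Small enough that `A s ≤ 1`, so that the dependence on the new mass can be absorbed on the
  -- left.
  set s : ℝ := 1 / (A + 1) with hs
  have hs0 : 0 < s := by positivity
  have hAs : A * s ≤ 1 := by
    rw [hs, mul_one_div, div_le_one (by positivity)]
    linarith
  set c : ℝ := N * B / w / s with hc
  have hc0 : 0 ≤ c := by positivity
  set M₀ := T.mass G₀ with hM₀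
  set b := 2 * A * c with hb
  have hb0 : 0 ≤ b := by positivity
  refine ⟨2 ^ N * (|M₀| + b) + (c + s / 2 * (2 ^ N * (|M₀| + b))), fun μ hμ hact => ?_⟩
  obtain ⟨hce, h0, -, hpsd⟩ := hμ
  have hact' := T.action_le_of_curveAction_le hN hact
  have hNB : 0 ≤ N * B := by positivity
  have hmidpsd : ∀ (i : Fin N) v, ((1 / 2 : ℝ) • (μ.G i.castSucc v + μ.G i.succ v)).PosSemidef :=
    fun i v => posSemidef_midpoint (hpsd i.castSucc v) (hpsd i.succ v)
  have hent := fun i : Fin N => T.abs_entry_le_of_action_le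
    (G := fun v => (1 / 2 : ℝ) • (μ.G i.castSucc v + μ.G i.succ v)) hw hwK hwv (hmidpsd i) hNB
    (hact' i) hs0
  simp only [mass_midpoint] at hent
  have hm0 : ∀ i, 0 ≤ T.mass (μ.G i) := fun i => T.mass_nonneg (hpsd i)
  -- Gronwall step for an implicit scheme: for old mass `x` and new mass `y`, `N (y - x) ≤ A c + (x
  -- + y)/4`. If `y > x`, then `N ≥ 1` yields `3y/4 ≤ 5x/4 + A c`, which is stronger than the claim.
  have hstep : ∀ i : Fin N, T.mass (μ.G i.succ) ≤ 2 * T.mass (μ.G i.castSucc) + b := by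
    intro i
    set x := T.mass (μ.G i.castSucc) with hx
    set y := T.mass (μ.G i.succ) with hy
    have hx0 : 0 ≤ x := hm0 _
    have hy0 : 0 ≤ y := hm0 _
    set β := c + s / 2 * (1 / 2 * (x + y)) with hβ
    have hβ0 : 0 ≤ β := by positivity
    have h1 : N * (y - x) = ∑ v, ∑ a, (-T.Dsig D (μ.q i) v + symPart (μ.R i v)) a a := by
      simp only [hx, hy, mass, ← Finset.sum_sub_distrib, Finset.mul_sum, ← hce i]
      refine Finset.sum_congr rfl fun v _ => ?_
      rw [← Matrix.trace_sub, ← smul_eq_mul, ← Matrix.trace_smul]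
      rfl
    have h2 : N * (y - x) ≤ A * β := by
      rw [h1]
      calc _ ≤ ∑ _v : T.vertices, ∑ _a : Fin n, (A₁ + 1) * β := by
            refine Finset.sum_le_sum fun v _ => Finset.sum_le_sum fun a _ => ?_
            have e1 := hA₁' (μ.q i) β hβ0 (hent i).1 v a a
            have e2 := (hent i).2 v a a
            rw [Matrix.add_apply, Matrix.neg_apply, symPart_apply]
            have := neg_abs_le (T.Dsig D (μ.q i) v a a)
            have := le_abs_self (μ.R i v a a)
            linarith
        _ = A * β := by
            simp [hA]
            ring
    have h3 : A * β ≤ A * c + 1 / 4 * (x + y) := by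
      have : A * s * (1 / 4 * (x + y)) ≤ 1 * (1 / 4 * (x + y)) := by gcongr
      rw [hβ]
      linarith
    by_cases hxy : y ≤ x
    · linarith
    · have : 1 * (y - x) ≤ N * (y - x) := by
        gcongr
        linarith
      rw [hb]
      nlinarith
  -- The recursion says that mass plus `b` at most doubles in each step.
  have hmass : ∀ i : Fin (N + 1), T.mass (μ.G i) ≤ 2 ^ (i : ℕ) * (|M₀| + b) - b := by
    intro i
    induction i using Fin.induction with
    | zero =>
      rw [h0]
      have := le_abs_self M₀
      simp only [Fin.val_zero, pow_zero]
      linarith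
    | succ i ih =>
      have := hstep i
      rw [Fin.val_castSucc] at ih
      rw [Fin.val_succ, pow_succ]
      linarith
  have hmass' : ∀ i, T.mass (μ.G i) ≤ 2 ^ N * (|M₀| + b) := by
    intro i
    have h1 : (2 : ℝ) ^ (i : ℕ) ≤ 2 ^ N := pow_le_pow_right₀ (by norm_num) (by omega)
    have h2 : (2 : ℝ) ^ (i : ℕ) * (|M₀| + b) ≤ 2 ^ N * (|M₀| + b) := by gcongr
    linarith [hmass i]
  have hP : 0 ≤ 2 ^ N * (|M₀| + b) := by positivity
  have hQ : 0 ≤ c + s / 2 * (2 ^ N * (|M₀| + b)) := by positivity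
  have hmid : ∀ i : Fin N, c + s / 2 * (1 / 2 * (T.mass (μ.G i.castSucc) + T.mass (μ.G i.succ))) ≤
      c + s / 2 * (2 ^ N * (|M₀| + b)) := by
    intro i
    refine add_le_add le_rfl (mul_le_mul_of_nonneg_left ?_ (by positivity))
    linarith [hmass' i.castSucc, hmass' i.succ]
  refine ⟨fun i v a b => ?_, fun i K a b => ?_, fun i v a b => ?_⟩
  · have := abs_entry_le_trace (hpsd i v) a b
    linarith [T.trace_le_mass (hpsd i) v, hmass' i]
  · linarith [(hent i).1 K a b, hmid i]
  · linarith [(hent i).2 v a b, hmid i]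

end Mesh

/-! ### Existence of minimizers -/

theorem continuous_frob {α : Type*} [TopologicalSpace α] {n m : ℕ} {A B : α → Mat n m}
    (hA : Continuous A) (hB : Continuous B) : Continuous fun a => frob (A a) (B a) :=
  (hA.matrix_transpose.matrix_mul hB).matrix_trace

/-- For fixed `Z` the bracket is continuous in `X` and `Y`, and a supremum of continuous functions
is lower semicontinuous. -/
theorem lowerSemicontinuous_dualCost {α : Type*} [TopologicalSpace α] {n m : ℕ} {X : α → Mat n n}
    {Y : α → Mat n m} (hX : Continuous X) (hY : Continuous Y) (c : ℝ) :
    LowerSemicontinuous fun a => ENNReal.ofReal c * dualCost (X a) (Y a) := by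
  simp only [dualCost, ENNReal.mul_iSup]
  refine lowerSemicontinuous_iSup fun Z => Continuous.lowerSemicontinuous ?_
  refine (ENNReal.continuous_const_mul ENNReal.ofReal_ne_top).comp
    (ENNReal.continuous_ofReal.comp ?_)
  exact (continuous_frob hY continuous_const).sub (continuous_const.mul
    (continuous_frob continuous_const (hX.matrix_mul continuous_const)))

theorem isCompact_box (ι κ : Type*) (n m : ℕ) (C : ℝ) :
    IsCompact {G : ι → κ → Mat n m | ∀ i v a b, |G i v a b| ≤ C} := by
  have e : {G : ι → κ → Mat n m | ∀ i v a b, |G i v a b| ≤ C} =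
      univ.pi fun _ => univ.pi fun _ => univ.pi fun _ => univ.pi fun _ => Icc (-C) C := by
    ext G
    exact ⟨fun h i _ v _ a _ b _ => abs_le.1 (h i v a b),
      fun h i v a b => abs_le.2 (h i trivial v trivial a trivial b trivial)⟩
  rw [e]
  exact isCompact_univ_pi fun _ => isCompact_univ_pi fun _ => isCompact_univ_pi fun _ =>
    isCompact_univ_pi fun _ => isCompact_Icc

theorem isClosed_posSemidef (n : ℕ) : IsClosed {A : Mat n n | A.PosSemidef} := by
  have e : {A : Mat n n | A.PosSemidef} =
      {A | Aᵀ = A} ∩ ⋂ x : Fin n → ℝ, {A | 0 ≤ x ⬝ᵥ A *ᵥ x} := by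
    ext A
    simp only [mem_ofPred_eq, mem_inter_iff, mem_iInter]
    constructor
    · exact fun h => ⟨transpose_eq_of_posSemidef h, fun x => by
        simpa using h.dotProduct_mulVec_nonneg x⟩
    · rintro ⟨h, h'⟩
      exact Matrix.PosSemidef.of_dotProduct_mulVec_nonneg (by simpa [Matrix.IsHermitian] using h)
        fun x => by simpa using h' x
  rw [e]
  refine (isClosed_eq continuous_id.matrix_transpose continuous_id).inter
    (isClosed_iInter fun x => isClosed_le continuous_const ?_)
  exact continuous_const.dotProduct (continuous_id.matrix_mulVec continuous_const)

namespace Mesh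

variable {d n k : ℕ} {Ω : Set (Eucl d)} (T : Mesh d Ω)

/-- The fields of a discrete curve, as a topological space. -/
abbrev CurveFields (n k N : ℕ) :=
  (Fin (N + 1) → T.vertices → Mat n n) × (Fin N → T.simplices → Mat n k) ×
    (Fin N → T.vertices → Mat n n)

/-- The curve with given fields. -/
def curveOfFields {N : ℕ} (e : T.CurveFields n k N) : T.Curve n k N := ⟨e.1, e.2.1, e.2.2⟩

/-- The action of a curve in terms of the Legendre representation of the cost. -/
def dualAction {N : ℕ} (e : T.CurveFields n k N) : ℝ≥0∞ :=
  ∑ i : Fin N,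
    (∑ K, ENNReal.ofReal (1 / N * T.vol K) * dualCost ((d + 1 : ℝ)⁻¹ • ∑ v ∈ T.verts K,
        (1 / 2 : ℝ) • (e.1 i.castSucc v + e.1 i.succ v)) (e.2.1 i K) +
      ∑ v, ENNReal.ofReal (1 / N * T.nodeVol v) *
        dualCost ((1 / 2 : ℝ) • (e.1 i.castSucc v + e.1 i.succ v)) (e.2.2 i v))

theorem curveAction_eq_dualAction {N : ℕ} {e : T.CurveFields n k N}
    (h : ∀ i v, (e.1 i v).PosSemidef) : T.curveAction (T.curveOfFields e) = T.dualAction e := by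
  have hN : (0 : ℝ) ≤ 1 / N := by positivity
  rw [curveAction, dualAction, Finset.mul_sum]
  refine Finset.sum_congr rfl fun i _ => ?_
  have hm : ∀ v, ((1 / 2 : ℝ) • (e.1 i.castSucc v + e.1 i.succ v)).PosSemidef := fun v =>
    posSemidef_midpoint (h _ v) (h _ v)
  rw [action, mul_add, Finset.mul_sum, Finset.mul_sum]
  congr 1
  · refine Finset.sum_congr rfl fun K _ => ?_
    rw [ENNReal.ofReal_mul hN, mul_assoc, ← quadCost_eq_dualCost (T.posSemidef_mean K hm)]
    rfl
  · refine Finset.sum_congr rfl fun v _ => ?_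
    rw [ENNReal.ofReal_mul hN, mul_assoc, ← quadCost_eq_dualCost (hm v)]
    rfl

theorem lowerSemicontinuous_dualAction (N : ℕ) :
    LowerSemicontinuous (T.dualAction : T.CurveFields n k N → ℝ≥0∞) := by
  have h1 : ∀ i v, Continuous fun e : T.CurveFields n k N => e.1 i v := fun i v =>
    (continuous_apply v).comp ((continuous_apply i).comp continuous_fst)
  have h2 : ∀ i K, Continuous fun e : T.CurveFields n k N => e.2.1 i K := fun i K =>
    (continuous_apply K).comp ((continuous_apply i).comp (continuous_fst.comp continuous_snd))
  have h3 : ∀ i v, Continuous fun e : T.CurveFields n k N => e.2.2 i v := fun i v =>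
    (continuous_apply v).comp ((continuous_apply i).comp (continuous_snd.comp continuous_snd))
  have hm : ∀ (i : Fin N) v, Continuous fun e : T.CurveFields n k N =>
      (1 / 2 : ℝ) • (e.1 i.castSucc v + e.1 i.succ v) := fun i v =>
    ((h1 _ v).fun_add (h1 _ v)).fun_const_smul _
  have hK : ∀ (i : Fin N) K, Continuous fun e : T.CurveFields n k N => (d + 1 : ℝ)⁻¹ •
      ∑ v ∈ T.verts K, (1 / 2 : ℝ) • (e.1 i.castSucc v + e.1 i.succ v) := fun i K =>
    (continuous_finsetSum _ fun v _ => hm i v).fun_const_smul _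
  unfold dualAction
  refine lowerSemicontinuous_sum fun i _ => LowerSemicontinuous.add
    (lowerSemicontinuous_sum fun K _ => ?_) (lowerSemicontinuous_sum fun v _ => ?_)
  · exact lowerSemicontinuous_dualCost (hK i K) (h2 i K) _
  · exact lowerSemicontinuous_dualCost (hm i v) (h3 i v) _

theorem isClosed_discreteCE (D : DiffOp d n k) (N : ℕ) (G₀ G₁ : T.vertices → Mat n n) :
    IsClosed {e : T.CurveFields n k N | T.curveOfFields e ∈ T.discreteCE D N G₀ G₁} := by
  have h1 : ∀ i v, Continuous fun e : T.CurveFields n k N => e.1 i v := fun i v =>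
    (continuous_apply v).comp ((continuous_apply i).comp continuous_fst)
  have h2 : ∀ i K, Continuous fun e : T.CurveFields n k N => e.2.1 i K := fun i K =>
    (continuous_apply K).comp ((continuous_apply i).comp (continuous_fst.comp continuous_snd))
  have h3 : ∀ i v, Continuous fun e : T.CurveFields n k N => e.2.2 i v := fun i v =>
    (continuous_apply v).comp ((continuous_apply i).comp (continuous_snd.comp continuous_snd))
  have hD : ∀ i v, Continuous fun e : T.CurveFields n k N => T.Dsig D (e.2.1 i) v := by
    intro i v
    refine continuous_matrix fun a b => ?_
    simp only [Dsig, Matrix.of_apply]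
    exact continuous_const.mul (continuous_finsetSum _ fun K _ => continuous_const.mul
      (continuous_frob (h2 i K) continuous_const))
  have hS : ∀ i v, Continuous fun e : T.CurveFields n k N => symPart (e.2.2 i v) := fun i v =>
    ((h3 i v).fun_add (h3 i v).matrix_transpose).fun_const_smul (1 / 2 : ℝ)
  have e : {e : T.CurveFields n k N | T.curveOfFields e ∈ T.discreteCE D N G₀ G₁} =
      (⋂ i : Fin N, ⋂ v, {e | (N : ℝ) • (e.1 i.succ v - e.1 i.castSucc v) =
        -T.Dsig D (e.2.1 i) v + symPart (e.2.2 i v)}) ∩ ({e | e.1 0 = G₀} ∩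
        ({e | e.1 (Fin.last N) = G₁} ∩ ⋂ i, ⋂ v, {e | (e.1 i v).PosSemidef})) := by
    ext e
    simp only [mem_inter_iff, mem_iInter, mem_ofPred_eq, discreteCE, curveOfFields]
  have hl : ∀ (i : Fin N) v, Continuous fun e : T.CurveFields n k N =>
      (N : ℝ) • (e.1 i.succ v - e.1 i.castSucc v) := fun i v =>
    ((h1 _ v).fun_sub (h1 _ v)).fun_const_smul _
  have hr : ∀ (i : Fin N) v, Continuous fun e : T.CurveFields n k N =>
      -T.Dsig D (e.2.1 i) v + symPart (e.2.2 i v) := fun i v => (hD i v).fun_neg.fun_add (hS i v)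
  rw [e]
  refine (isClosed_iInter fun i => isClosed_iInter fun v => isClosed_eq (hl i v) (hr i v)).inter
    (IsClosed.inter ?_ (IsClosed.inter ?_ ?_))
  · exact isClosed_eq ((continuous_apply _).comp continuous_fst) continuous_const
  · exact isClosed_eq ((continuous_apply _).comp continuous_fst) continuous_const
  · exact isClosed_iInter fun i => isClosed_iInter fun v =>
      (isClosed_posSemidef n).preimage (h1 i v)

/-- Direct method. The root curve supplies a finite level `B`, admissible curves below that level
lie in a compact set, and on admissible curves the action equals the lower semicontinuous
`dualAction`. -/
theorem exists_minimizer (hΩ : IsCompact Ω) (D : DiffOp d n k) {N : ℕ} (hN : 0 < N)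
    {G₀ G₁ : T.vertices → Mat n n} (h₀ : ∀ v, (G₀ v).PosSemidef) (h₁ : ∀ v, (G₁ v).PosSemidef) :
    ∃ μ ∈ T.discreteCE D N G₀ G₁, ∀ ν ∈ T.discreteCE D N G₀ G₁,
      T.curveAction μ ≤ T.curveAction ν := by
  obtain ⟨B, hB, hle⟩ : ∃ B, 0 ≤ B ∧ T.curveAction (T.rootCurve k N G₀ G₁) ≤ ENNReal.ofReal B :=
    ⟨_, mul_nonneg (by norm_num) (Finset.sum_nonneg fun v _ => mul_nonneg (T.nodeVol_pos hΩ v).le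
      (frob_self_nonneg _)), T.curveAction_rootCurve_le hΩ hN G₀ G₁⟩
  have hmem := T.rootCurve_mem D hN h₀ h₁
  obtain ⟨C, hC⟩ := T.exists_bound hΩ D hN G₀ G₁ hB
  set S : Set (T.CurveFields n k N) := {e | T.curveOfFields e ∈ T.discreteCE D N G₀ G₁} ∩
    ({G | ∀ i v a b, |G i v a b| ≤ C} ×ˢ ({q | ∀ i v a b, |q i v a b| ≤ C} ×ˢ
      {R | ∀ i v a b, |R i v a b| ≤ C})) with hS
  have hScomp : IsCompact S := IsCompact.inter_left ((isCompact_box _ _ _ _ C).prod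
    ((isCompact_box _ _ _ _ C).prod (isCompact_box _ _ _ _ C)))
    (T.isClosed_discreteCE D N G₀ G₁)
  have hin : ∀ ν ∈ T.discreteCE D N G₀ G₁, T.curveAction ν ≤ ENNReal.ofReal B →
      (ν.G, ν.q, ν.R) ∈ S := fun ν hν hνB => ⟨hν, (hC ν hν hνB).1, (hC ν hν hνB).2⟩
  obtain ⟨e, heS, hmin⟩ := (T.lowerSemicontinuous_dualAction N).lowerSemicontinuousOn S
    |>.exists_isMinOn ⟨_, hin _ hmem hle⟩ hScomp
  have hval : ∀ ν ∈ T.discreteCE D N G₀ G₁, T.curveAction ν ≤ ENNReal.ofReal B →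
      T.curveAction (T.curveOfFields e) ≤ T.curveAction ν := by
    intro ν hν hνB
    have h := hmin (hin ν hν hνB)
    rw [mem_ofPred_eq, ← T.curveAction_eq_dualAction heS.1.2.2.2,
      ← T.curveAction_eq_dualAction (e := (ν.G, ν.q, ν.R)) hν.2.2.2] at h
    exact h
  refine ⟨T.curveOfFields e, heS.1, fun ν hν => ?_⟩
  -- A competitor above the level `B`, possibly of infinite action, already loses to the root curve.
  by_cases hνB : T.curveAction ν ≤ ENNReal.ofReal B
  · exact hval ν hν hνB
  · exact ((hval _ hmem hle).trans hle).trans (not_le.1 hνB).le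

end Mesh

/-! ### Mollification -/

section Mollifier

theorem lintegral_comp_smul_add {d : ℕ} {s : ℝ} (hs : 0 < s) (b : Eucl d) {F : Eucl d → ℝ≥0∞}
    (hF : Measurable F) : ENNReal.ofReal (s ^ d) * ∫⁻ x, F (s • x + b) = ∫⁻ x, F x := by
  have h1 : ∫⁻ x, F (s • x + b) = ∫⁻ y, F (y + b) ∂(Measure.map (s • ·) volume) := by
    exact (lintegral_map (f := fun y => F (y + b)) (hF.comp (measurable_add_const b))
      (measurable_const_smul s)).symm
  rw [h1, Measure.map_addHaar_smul _ hs.ne', lintegral_smul_measure, lintegral_add_right_eq_self,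
    finrank_euclideanSpace_fin, abs_of_pos (by positivity), smul_eq_mul, ← mul_assoc,
    ← ENNReal.ofReal_mul (by positivity), mul_inv_cancel₀ (by positivity), ENNReal.ofReal_one,
    one_mul]

variable {F : Type*} [NormedAddCommGroup F] [NormedSpace ℝ F] [MeasureSpace F] {θ : F → ℝ}

theorem IsMollifier.eq_zero (h : IsMollifier θ) {x : F} (hx : 1 < ‖x‖) : θ x = 0 := by
  by_contra h0
  have := h.supp (subset_tsupport θ h0)
  rw [mem_closedBall_zero_iff] at this
  linarith

theorem IsMollifier.hasCompactSupport [ProperSpace F] (h : IsMollifier θ) : HasCompactSupport θ :=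
  (isCompact_closedBall (0 : F) 1).of_isClosed_subset (isClosed_tsupport θ) h.supp

theorem IsMollifier.exists_norm_le [ProperSpace F] (h : IsMollifier θ) : ∃ C, ∀ x, ‖θ x‖ ≤ C :=
  h.hasCompactSupport.exists_bound_of_continuous h.smooth.continuous

theorem IsMollifier.integrable (h : IsMollifier θ) : Integrable θ :=
  -- The Bochner integral of a nonintegrable function is zero, so integral one entails
  -- integrability.
  Integrable.of_integral_ne_zero (by rw [h.integral_eq]; exact one_ne_zero)

theorem IsMollifier.lintegral_eq (h : IsMollifier θ) : ∫⁻ x, ENNReal.ofReal (θ x) = 1 := by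
  rw [← ofReal_integral_eq_lintegral_ofReal h.integrable (Eventually.of_forall h.nonneg),
    h.integral_eq, ENNReal.ofReal_one]

end Mollifier

namespace Regularizer

variable {d n k : ℕ} {Ω : Set (Eucl d)} {D : DiffOp d n k} (reg : Regularizer Ω D)

theorem kerX_nonneg {ε : ℝ} (hε : 0 < ε) (x : Eucl d) : 0 ≤ reg.kerX ε x :=
  mul_nonneg (pow_nonneg (inv_nonneg.2 hε.le) _) (reg.θx_moll.nonneg _)

theorem kerT_eq_zero {ε t : ℝ} (hε : 0 < ε) (h : ε < |t|) : reg.kerT ε t = 0 := by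
  rw [kerT, reg.θt_moll.eq_zero, mul_zero]
  rwa [Real.norm_eq_abs, abs_mul, abs_of_pos (inv_pos.2 hε), ← div_eq_inv_mul, one_lt_div hε]

theorem kerX_eq_zero {ε : ℝ} {x : Eucl d} (hε : 0 < ε) (h : ε < ‖x‖) : reg.kerX ε x = 0 := by
  rw [kerX, reg.θx_moll.eq_zero, mul_zero]
  rwa [norm_smul, Real.norm_eq_abs, abs_of_pos (inv_pos.2 hε), ← div_eq_inv_mul, one_lt_div hε]

theorem continuous_kerX (ε : ℝ) : Continuous (reg.kerX ε) :=
  continuous_const.mul (reg.θx_moll.smooth.continuous.comp (continuous_const_smul _))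

theorem exists_norm_kerX_le (ε : ℝ) : ∃ C, ∀ x, ‖reg.kerX ε x‖ ≤ C := by
  obtain ⟨C, hC⟩ := reg.θx_moll.exists_norm_le
  refine ⟨‖ε⁻¹ ^ d‖ * C, fun x => ?_⟩
  rw [kerX, norm_mul]
  exact mul_le_mul_of_nonneg_left (hC _) (norm_nonneg _)

theorem integral_kerT {ε : ℝ} (hε : 0 < ε) (t : ℝ) : ∫ s, reg.kerT ε (t - s) = 1 := by
  rw [integral_sub_left_eq_self (fun s => reg.kerT ε s) volume t]
  simp only [kerT]
  rw [integral_const_mul, Measure.integral_comp_mul_left, reg.θt_moll.integral_eq, inv_inv,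
    abs_of_pos hε, smul_eq_mul, mul_one, inv_mul_cancel₀ hε.ne']

theorem integral_kerX_mul {ε : ℝ} (hε : 0 < ε) (g : Eucl d → ℝ) (y : Eucl d) :
    ∫ z, reg.kerX ε (y - z) * g z = ∫ w, reg.θx w * g (y - ε • w) := by
  have h1 : ∫ z, reg.kerX ε (y - z) * g z = ∫ z, reg.kerX ε z * g (y - z) := by
    rw [← integral_sub_left_eq_self (fun z => reg.kerX ε z * g (y - z)) volume y]
    simp only [sub_sub_cancel]
  have h2 := Measure.integral_comp_smul (volume : Measure (Eucl d))
    (fun w => reg.θx w * g (y - ε • w)) ε⁻¹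
  rw [finrank_euclideanSpace_fin, abs_of_pos (by positivity)] at h2
  rw [h1]
  simp only [kerX, mul_assoc]
  rw [integral_const_mul]
  simp only [smul_inv_smul₀ hε.ne'] at h2
  rw [h2, smul_eq_mul, ← mul_assoc, mul_inv_cancel₀ (by positivity), one_mul]

/-- The density of the compression of the mollification of a scalar function. -/
def smooth (ε : ℝ) (g : Eucl d → ℝ) (x : Eucl d) : ℝ :=
  (1 + (reg.L : ℝ) * ε) ^ d * ∫ z, reg.kerX ε (reg.invX ε x - z) * g z

theorem smooth_eq {ε : ℝ} (hε : 0 < ε) (g : Eucl d → ℝ) (x : Eucl d) : reg.smooth ε g x =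
    (1 + (reg.L : ℝ) * ε) ^ d * ∫ w, reg.θx w * g (reg.invX ε x - ε • w) := by
  rw [smooth, integral_kerX_mul reg hε]

theorem continuous_invX (ε : ℝ) : Continuous (reg.invX ε) := by
  unfold invX
  fun_prop

theorem measurable_smooth (ε : ℝ) {g : Eucl d → ℝ} (hg : Measurable g) :
    Measurable (reg.smooth ε g) := by
  have h : StronglyMeasurable fun p : Eucl d × Eucl d =>
      reg.kerX ε (reg.invX ε p.1 - p.2) * g p.2 := by
    apply Measurable.stronglyMeasurable
    exact ((reg.continuous_kerX ε).measurable.comp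
      (((reg.continuous_invX ε).measurable.comp measurable_fst).sub measurable_snd)).mul
      (hg.comp measurable_snd)
  exact h.integral_prod_right.measurable.const_mul _

theorem integrable_kerX_mul (ε : ℝ) (y : Eucl d) {g : Eucl d → ℝ} (hg : Integrable g) :
    Integrable fun z => reg.kerX ε (y - z) * g z := by
  obtain ⟨C, hC⟩ := reg.exists_norm_kerX_le ε
  exact hg.bdd_mul (c := C) ((reg.continuous_kerX ε).comp
    (continuous_const.sub continuous_id)).aestronglyMeasurable (Eventually.of_forall fun z => hC _)

theorem smooth_sub (ε : ℝ) {f g : Eucl d → ℝ} (hf : Integrable f) (hg : Integrable g)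
    (x : Eucl d) : reg.smooth ε (fun z => f z - g z) x = reg.smooth ε f x - reg.smooth ε g x := by
  simp only [smooth, mul_sub]
  rw [integral_sub (reg.integrable_kerX_mul ε _ hf) (reg.integrable_kerX_mul ε _ hg), mul_sub]

theorem one_add_L_mul_pos {ε : ℝ} (hε : 0 < ε) : 0 < 1 + (reg.L : ℝ) * ε := by
  have := reg.L.2
  positivity

/-- Contraction in `L¹`: after Tonelli, the factor `(1 + Lε)^d` is the Jacobian of the compression,
and the kernel has mass one. -/
theorem lintegral_smooth_le {ε : ℝ} (hε : 0 < ε) {g : Eucl d → ℝ} (hg : Measurable g) :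
    ∫⁻ x, ‖reg.smooth ε g x‖ₑ ≤ ∫⁻ x, ‖g x‖ₑ := by
  set s := 1 + (reg.L : ℝ) * ε with hs
  have hs0 : 0 < s := reg.one_add_L_mul_pos hε
  have hinv : ∀ x w, reg.invX ε x - ε • w = s • x + (reg.center - s • reg.center - ε • w) := by
    intro x w
    rw [invX, smul_sub]
    abel
  have hθm : Measurable fun w => ENNReal.ofReal (reg.θx w) :=
    reg.θx_moll.smooth.continuous.measurable.ennreal_ofReal
  have hm : Measurable fun p : Eucl d × Eucl d =>
      ENNReal.ofReal (reg.θx p.2) * ‖g (reg.invX ε p.1 - ε • p.2)‖ₑ := by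
    refine (hθm.comp measurable_snd).mul (hg.comp ?_).enorm
    exact ((reg.continuous_invX ε).measurable.comp measurable_fst).sub
      (measurable_snd.const_smul ε)
  calc ∫⁻ x, ‖reg.smooth ε g x‖ₑ
      ≤ ∫⁻ x, ENNReal.ofReal (s ^ d) *
          ∫⁻ w, ENNReal.ofReal (reg.θx w) * ‖g (reg.invX ε x - ε • w)‖ₑ := by
        refine lintegral_mono fun x => ?_
        rw [reg.smooth_eq hε, enorm_mul, Real.enorm_of_nonneg (by positivity)]
        gcongr
        refine (enorm_integral_le_lintegral_enorm _).trans_eq ?_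
        refine lintegral_congr fun w => ?_
        rw [enorm_mul, Real.enorm_of_nonneg (reg.θx_moll.nonneg w)]
    _ = ∫⁻ w, ENNReal.ofReal (reg.θx w) * (ENNReal.ofReal (s ^ d) *
          ∫⁻ x, ‖g (reg.invX ε x - ε • w)‖ₑ) := by
        rw [lintegral_const_mul' _ _ ENNReal.ofReal_ne_top,
          lintegral_lintegral_swap hm.aemeasurable,
          ← lintegral_const_mul' _ _ ENNReal.ofReal_ne_top]
        refine lintegral_congr fun w => ?_
        rw [lintegral_const_mul' _ _ ENNReal.ofReal_ne_top]
        ring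
    _ = ∫⁻ w, ENNReal.ofReal (reg.θx w) * ∫⁻ x, ‖g x‖ₑ := by
        refine lintegral_congr fun w => ?_
        simp only [hinv]
        rw [lintegral_comp_smul_add hs0 _ hg.enorm]
    _ = ∫⁻ x, ‖g x‖ₑ := by
        rw [lintegral_mul_const _ hθm, reg.θx_moll.lintegral_eq, one_mul]

/-- After rescaling, the kernel no longer depends on `ε`, and dominated convergence applies with
majorant `M θ`. -/
theorem tendsto_smooth_apply {f : Eucl d → ℝ} (hf : Continuous f) {M : ℝ} (hM : ∀ x, ‖f x‖ ≤ M)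
    (x : Eucl d) : Tendsto (fun ε => reg.smooth ε f x) (𝓝[>] 0) (𝓝 (f x)) := by
  have h1 : Tendsto (fun ε => (1 + (reg.L : ℝ) * ε) ^ d * ∫ w, reg.θx w *
      f (reg.invX ε x - ε • w)) (𝓝[>] 0) (𝓝 ((1 + (reg.L : ℝ) * 0) ^ d *
        ∫ w, reg.θx w * f (reg.invX 0 x - (0 : ℝ) • w))) := by
    refine Tendsto.mul ?_ ?_
    · exact (Continuous.tendsto (by fun_prop) 0).mono_left nhdsWithin_le_nhds
    · refine tendsto_integral_filter_of_dominated_convergence (fun w => reg.θx w * M) ?_ ?_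
        (reg.θx_moll.integrable.mul_const M) ?_
      · refine Eventually.of_forall fun ε => Continuous.aestronglyMeasurable ?_
        exact reg.θx_moll.smooth.continuous.mul (hf.comp
          (continuous_const.sub (continuous_const_smul ε)))
      · refine Eventually.of_forall fun ε => Eventually.of_forall fun w => ?_
        rw [norm_mul, Real.norm_of_nonneg (reg.θx_moll.nonneg w)]
        exact mul_le_mul_of_nonneg_left (hM _) (reg.θx_moll.nonneg w)
      · refine Eventually.of_forall fun w => Tendsto.mul tendsto_const_nhds ?_
        have hc : Continuous fun ε : ℝ => f (reg.invX ε x - ε • w) := by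
          unfold invX
          fun_prop
        exact (hc.tendsto 0).mono_left nhdsWithin_le_nhds
  have h2 : (1 + (reg.L : ℝ) * 0) ^ d * ∫ w, reg.θx w * f (reg.invX 0 x - (0 : ℝ) • w) = f x := by
    simp only [invX, mul_zero, add_zero, one_smul, zero_smul, sub_zero, add_sub_cancel, one_pow,
      one_mul]
    rw [integral_mul_const, reg.θx_moll.integral_eq, one_mul]
  rw [h2] at h1
  refine h1.congr' ?_
  filter_upwards [self_mem_nhdsWithin] with ε hε
  exact (reg.smooth_eq hε f x).symm

theorem tendsto_lintegral_smooth_sub_of_continuous {f : Eucl d → ℝ} (hf : Continuous f)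
    (hfc : HasCompactSupport f) :
    Tendsto (fun ε => ∫⁻ x, ‖reg.smooth ε f x - f x‖ₑ) (𝓝[>] 0) (𝓝 0) := by
  obtain ⟨M, hM⟩ := hfc.exists_bound_of_continuous hf
  have hM0 : 0 ≤ M := (norm_nonneg _).trans (hM 0)
  obtain ⟨r, hr⟩ := hfc.isCompact.isBounded.subset_closedBall reg.center
  have hf0 : ∀ x, r < dist x reg.center → f x = 0 := by
    intro x hx
    by_contra h0
    exact not_lt.2 (hr (subset_tsupport f h0)) hx
  have hL := reg.L.2
  set C : ℝ := (1 + (reg.L : ℝ)) ^ d * M + M with hC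
  -- For `0 < ε < 1`, `invX` does not decrease distances to the center and the kernel shifts by at
  -- most `1`. Hence both functions vanish outside the ball of radius `r + 1`.
  set bound : Eucl d → ℝ≥0∞ := (Metric.closedBall reg.center (r + 1)).indicator
    fun _ => ENNReal.ofReal C with hbound
  have key : Tendsto (fun ε => ∫⁻ x, ‖reg.smooth ε f x - f x‖ₑ) (𝓝[>] 0)
      (𝓝 (∫⁻ _x : Eucl d, 0)) := by
    refine tendsto_lintegral_filter_of_dominated_convergence bound ?_ ?_ ?_ ?_
    · exact Eventually.of_forall fun ε =>
        ((reg.measurable_smooth ε hf.measurable).sub hf.measurable).enorm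
    · filter_upwards [Ioo_mem_nhdsGT (zero_lt_one' ℝ)] with ε hε
      refine Eventually.of_forall fun x => ?_
      by_cases hx : x ∈ Metric.closedBall reg.center (r + 1)
      · rw [hbound, indicator_of_mem hx, ← ofReal_norm]
        apply ENNReal.ofReal_le_ofReal
        refine (norm_sub_le _ _).trans (add_le_add ?_ (hM x))
        rw [reg.smooth_eq hε.1, norm_mul, Real.norm_of_nonneg
          (pow_nonneg (reg.one_add_L_mul_pos hε.1).le _)]
        refine mul_le_mul ?_ ?_ (norm_nonneg _) (by positivity)
        · refine pow_le_pow_left₀ (reg.one_add_L_mul_pos hε.1).le ?_ _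
          have := mul_le_mul_of_nonneg_left hε.2.le hL
          simp only [NNReal.val_eq_coe, mul_one] at this
          linarith
        · calc ‖∫ w, reg.θx w * f (reg.invX ε x - ε • w)‖ ≤ ∫ w, reg.θx w * M := by
                refine norm_integral_le_of_norm_le (reg.θx_moll.integrable.mul_const M)
                  (Eventually.of_forall fun w => ?_)
                rw [norm_mul, Real.norm_of_nonneg (reg.θx_moll.nonneg w)]
                exact mul_le_mul_of_nonneg_left (hM _) (reg.θx_moll.nonneg w)
            _ = M := by rw [integral_mul_const, reg.θx_moll.integral_eq, one_mul]
      · rw [Metric.mem_closedBall, not_le] at hx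
        have h1 : f x = 0 := hf0 x (by linarith)
        have h2 : ∀ w, reg.θx w * f (reg.invX ε x - ε • w) = 0 := by
          intro w
          by_cases hw : 1 < ‖w‖
          · rw [reg.θx_moll.eq_zero hw, zero_mul]
          · rw [hf0, mul_zero]
            have e1 : dist x reg.center ≤ ‖(1 + (reg.L : ℝ) * ε) • (x - reg.center)‖ := by
              rw [dist_eq_norm, norm_smul, Real.norm_of_nonneg (reg.one_add_L_mul_pos hε.1).le]
              refine le_mul_of_one_le_left (norm_nonneg _) ?_
              have := mul_nonneg hL hε.1.le
              simp only [NNReal.val_eq_coe] at this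
              linarith
            have e2 : ‖ε • w‖ ≤ 1 := by
              rw [norm_smul, Real.norm_of_nonneg hε.1.le]
              exact mul_le_one₀ hε.2.le (norm_nonneg _) (not_lt.1 hw)
            have e3 : reg.invX ε x - ε • w - reg.center =
                (1 + (reg.L : ℝ) * ε) • (x - reg.center) - ε • w := by
              rw [invX]
              abel
            rw [dist_eq_norm (reg.invX ε x - ε • w), e3]
            have := norm_sub_norm_le ((1 + (reg.L : ℝ) * ε) • (x - reg.center)) (ε • w)
            linarith
        rw [reg.smooth_eq hε.1]
        simp [h1, h2]
    · rw [hbound, lintegral_indicator_const Metric.isClosed_closedBall.measurableSet]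
      exact ENNReal.mul_ne_top ENNReal.ofReal_ne_top
        (isCompact_closedBall _ _).measure_lt_top.ne
    · refine Eventually.of_forall fun x => ?_
      have := ((reg.tendsto_smooth_apply hf hM x).sub_const (f x)).enorm
      simpa using this
  simpa using key

/-- The mollifications converge in `L¹`. -/
theorem tendsto_lintegral_smooth_sub {g : Eucl d → ℝ} (hg : Measurable g) (hgi : Integrable g) :
    Tendsto (fun ε => ∫⁻ x, ‖reg.smooth ε g x - g x‖ₑ) (𝓝[>] 0) (𝓝 0) := by
  rw [ENNReal.tendsto_nhds_zero]
  intro δ hδ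
  have hδ3 : 0 < δ / 3 := ENNReal.div_pos hδ.ne' (by norm_num)
  -- Density of continuous, compactly supported functions in `L¹`. The contraction
  -- `lintegral_smooth_le` handles the smoothed remainder, uniformly in `ε`.
  obtain ⟨f, hfc, hfle, hf, hfi⟩ := hgi.exists_hasCompactSupport_lintegral_sub_le hδ3.ne'
  have h1 := ENNReal.tendsto_nhds_zero.1
    (reg.tendsto_lintegral_smooth_sub_of_continuous hf hfc) (δ / 3) hδ3
  filter_upwards [h1, self_mem_nhdsWithin] with ε h1 hε
  have hm : Measurable fun z => g z - f z := hg.sub hf.measurable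
  have m1 : Measurable fun x => ‖reg.smooth ε (fun z => g z - f z) x‖ₑ :=
    (reg.measurable_smooth ε hm).enorm
  have m2 : Measurable fun x => ‖reg.smooth ε f x - f x‖ₑ :=
    ((reg.measurable_smooth ε hf.measurable).sub hf.measurable).enorm
  calc ∫⁻ x, ‖reg.smooth ε g x - g x‖ₑ
      ≤ ∫⁻ x, (‖reg.smooth ε (fun z => g z - f z) x‖ₑ + ‖reg.smooth ε f x - f x‖ₑ +
          ‖g x - f x‖ₑ) := by
        refine lintegral_mono fun x => ?_
        have e : reg.smooth ε g x - g x = reg.smooth ε (fun z => g z - f z) x +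
            (reg.smooth ε f x - f x) - (g x - f x) := by
          rw [reg.smooth_sub ε hgi hfi]
          ring
        rw [e]
        exact (enorm_sub_le).trans (add_le_add (enorm_add_le _ _) le_rfl)
    _ = (∫⁻ x, ‖reg.smooth ε (fun z => g z - f z) x‖ₑ) + (∫⁻ x, ‖reg.smooth ε f x - f x‖ₑ) +
          ∫⁻ x, ‖g x - f x‖ₑ := by
        rw [lintegral_add_left (m1.fun_add m2), lintegral_add_left m1]
    _ ≤ δ / 3 + δ / 3 + δ / 3 :=
        add_le_add (add_le_add ((reg.lintegral_smooth_le hε hm).trans hfle) h1) hfle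
    _ = δ := ENNReal.add_thirds δ

theorem integrable_smooth {ε : ℝ} (hε : 0 < ε) {g : Eucl d → ℝ} (hg : Measurable g)
    (hgi : Integrable g) : Integrable (reg.smooth ε g) :=
  ⟨(reg.measurable_smooth ε hg).aestronglyMeasurable,
    (reg.lintegral_smooth_le hε hg).trans_lt hgi.2⟩

end Regularizer

/-! ### The endpoints of the regularization -/

theorem posSemidef_of_integral {α : Type*} [MeasurableSpace α] {ν : Measure α} {n : ℕ}
    {F : α → Mat n n} (h : ∀ x, (F x).PosSemidef) (hi : ∀ a b, Integrable (fun x => F x a b) ν) :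
    (Matrix.of fun a b => ∫ x, F x a b ∂ν : Mat n n).PosSemidef := by
  refine Matrix.PosSemidef.of_dotProduct_mulVec_nonneg ?_ fun v => ?_
  · ext a b
    simp only [Matrix.conjTranspose_apply, Matrix.of_apply, star_trivial]
    refine integral_congr_ae (Eventually.of_forall fun x => ?_)
    exact congrFun (congrFun (transpose_eq_of_posSemidef (h x)) a) b
  · have e : star v ⬝ᵥ (Matrix.of fun a b => ∫ x, F x a b ∂ν : Mat n n) *ᵥ v =
        ∫ x, star v ⬝ᵥ F x *ᵥ v ∂ν := by
      simp only [dotProduct, Matrix.mulVec, star_trivial, Matrix.of_apply, Finset.mul_sum]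
      rw [integral_finsetSum _ fun a _ => integrable_finsetSum _ fun b _ =>
        ((hi a b).mul_const _).const_mul _]
      refine Finset.sum_congr rfl fun a _ => ?_
      rw [integral_finsetSum _ fun b _ => ((hi a b).mul_const _).const_mul _]
      refine Finset.sum_congr rfl fun b _ => ?_
      rw [integral_const_mul, integral_mul_const]
    rw [e]
    exact integral_nonneg fun x => (h x).dotProduct_mulVec_nonneg v

/-- The Lebesgue density of a matrix-valued measure. -/
abbrev lebesgueDensity {d n : ℕ} (G : VectorMeasure (Eucl d) (Mat n n)) (a b : Fin n) :
    Eucl d → ℝ := (entry G a b).rnDeriv volume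

theorem integralScalar_apply_eq_integral {d n : ℕ} {G : VectorMeasure (Eucl d) (Mat n n)}
    (hG : G ≪ᵥ (volume : Measure (Eucl d)).toENNRealVectorMeasure) {f : Eucl d → ℝ}
    (hf : Measurable f) {C : ℝ} (hC : ∀ x, ‖f x‖ ≤ C) (a b : Fin n) :
    integralScalar G f a b = ∫ x, f x * lebesgueDensity G a b x := by
  have hac : entry G a b ≪ᵥ (volume : Measure (Eucl d)).toENNRealVectorMeasure := by
    intro s hs
    rw [entry_apply, hG hs, Matrix.zero_apply]
  have e := ((entry G a b).absolutelyContinuous_iff_withDensityᵥ_rnDeriv_eq volume).1 hac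
  rw [integralScalar, Matrix.of_apply]
  conv_lhs => rw [← e]
  exact integral_lsmul_withDensity ((entry G a b).measurable_rnDeriv volume)
    ((entry G a b).integrable_rnDeriv volume) hf hC

namespace Regularizer

variable {d n k : ℕ} {Ω : Set (Eucl d)} {D : DiffOp d n k} (reg : Regularizer Ω D)

theorem mollify_eq_zero {m : ℕ} {ε : ℝ} (hε : 0 < ε) (μ : VectorMeasure (ℝ × Eucl d) (Mat n m))
    {t : ℝ} (ht : ∀ s ∈ Ioo (0 : ℝ) 1, ε < |t - s|) (y : Eucl d) : reg.mollify ε μ t y = 0 := by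
  have e : ((Ioo (0 : ℝ) 1 ×ˢ (univ : Set (Eucl d))).indicator
      fun p => reg.kerT ε (t - p.1) * reg.kerX ε (y - p.2)) = fun _ => 0 := by
    funext p
    by_cases hp : p ∈ Ioo (0 : ℝ) 1 ×ˢ (univ : Set (Eucl d))
    · rw [indicator_of_mem hp, reg.kerT_eq_zero hε (ht _ hp.1), zero_mul]
    · exact indicator_of_notMem hp _
  rw [mollify, e]
  ext i j
  simp [integralScalar]

theorem integral_lift {ε : ℝ} (hε : 0 < ε) (t : ℝ) (y : Eucl d) (a b : Fin n) :
    ∫ p : ℝ × Eucl d, reg.kerT ε (t - p.1) * reg.kerX ε (y - p.2) * reg.lift p.2 a b =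
      ∫ z, reg.kerX ε (y - z) * reg.lift z a b := by
  simp only [mul_assoc]
  rw [Measure.volume_eq_prod, integral_prod_mul (fun s => reg.kerT ε (t - s))
    (fun z => reg.kerX ε (y - z) * reg.lift z a b), reg.integral_kerT hε, one_mul]

theorem setIntegral_kerT_eq_one {ε : ℝ} (hε : 0 < ε) {t : ℝ} {S : Set ℝ}
    (h : ∀ s ∉ S, ε < |t - s|) : ∫ s in S, reg.kerT ε (t - s) = 1 := by
  rw [setIntegral_eq_integral_of_forall_compl_eq_zero fun s hs => reg.kerT_eq_zero hε (h s hs),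
    reg.integral_kerT hε]

theorem setIntegral_kerT_eq_zero {ε : ℝ} (hε : 0 < ε) {t : ℝ} {S : Set ℝ}
    (h : ∀ s ∈ S, ε < |t - s|) : ∫ s in S, reg.kerT ε (t - s) = 0 :=
  setIntegral_eq_zero_of_forall_eq_zero fun s hs => reg.kerT_eq_zero hε (h s hs)

/-- The times `0` and `1` correspond to `-ε` and `1 + ε` before compression. A kernel of width `ε`
then sees only the constant extension, and nothing of the measure at times in `(0,1)`. -/
theorem mollifyG_endpoint {ε : ℝ} (hε : 0 < ε) (G : Fin 2 → VectorMeasure (Eucl d) (Mat n n))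
    (H : VectorMeasure (ℝ × Eucl d) (Mat n n)) (i : Fin 2) (y : Eucl d) :
    reg.mollifyG ε (G 0) (G 1) H (invT ε ((i : ℕ) : ℝ)) y =
      (1 - ε) • integralScalar (G i) (fun x => reg.kerX ε (y - x)) +
        ε • Matrix.of fun a b => ∫ z, reg.kerX ε (y - z) * reg.lift z a b := by
  rw [mollifyG]
  simp only [reg.integral_lift hε]
  congr 2
  -- The strict inequality uses `s > 0`, matching the restriction of the measure to the open time
  -- interval.
  have h0 : ∀ s : ℝ, 0 < s → ε < |-ε - s| := fun s hs => by
    rw [abs_of_neg (by linarith)]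
    linarith
  have h1 : ∀ s : ℝ, s < 1 → ε < |1 + ε - s| := fun s hs => by
    rw [abs_of_pos (by linarith)]
    linarith
  match i with
  | 0 =>
    have e : invT ε (((0 : Fin 2) : ℕ) : ℝ) = -ε := by simp [invT]
    rw [e, reg.mollify_eq_zero hε H fun s hs => h0 s hs.1,
      reg.setIntegral_kerT_eq_one (S := Iic 0) hε fun s hs => h0 s (not_le.1 hs),
      reg.setIntegral_kerT_eq_zero (S := Ici 1) hε fun s hs => h0 s (zero_lt_one.trans_le hs)]
    simp
  | 1 =>
    have e : invT ε (((1 : Fin 2) : ℕ) : ℝ) = 1 + ε := by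
      simp [invT]
      ring
    rw [e, reg.mollify_eq_zero hε H fun s hs => h1 s hs.2,
      reg.setIntegral_kerT_eq_zero (S := Iic 0) hε fun s hs => h1 s (lt_of_le_of_lt hs zero_lt_one),
      reg.setIntegral_kerT_eq_one (S := Ici 1) hε fun s hs => h1 s (not_le.1 hs)]
    simp

theorem measurable_kerX_sub (ε : ℝ) (y : Eucl d) : Measurable fun x => reg.kerX ε (y - x) :=
  ((reg.continuous_kerX ε).comp (continuous_const.sub continuous_id)).measurable

theorem measurable_lift (a b : Fin n) : Measurable fun x => reg.lift x a b :=
  (reg.lift_smooth a b).continuous.measurable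

theorem integrable_lift (hΩ : IsCompact Ω) (a b : Fin n) : Integrable fun x => reg.lift x a b := by
  refine (reg.lift_smooth a b).continuous.integrable_of_hasCompactSupport ?_
  refine HasCompactSupport.of_support_subset_isCompact (hΩ.cthickening (r := 1)) fun x hx => ?_
  refine reg.lift_supp (subset_tsupport _ fun h0 => hx ?_)
  exact congrFun (congrFun h0 a) b

/-! ### Positivity and `L¹` error of the regularized endpoint densities -/

variable {G : Fin 2 → VectorMeasure (Eucl d) (Mat n n)}

theorem posSemidef_densG_endpoint (hΩ : IsCompact Ω) {ε : ℝ} (hε : ε ∈ Ioo (0 : ℝ) 1)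
    (hG : ∀ i B, MeasurableSet B → (G i B).PosSemidef) (μ : TripleMeasure (ℝ × Eucl d) n k)
    (i : Fin 2) (x : Eucl d) :
    (reg.densG ε (G 0) (G 1) μ ((i : ℕ) : ℝ) x).PosSemidef := by
  rw [densG, compress]
  split_ifs
  · refine Matrix.PosSemidef.smul ?_ (pow_nonneg (reg.one_add_L_mul_pos hε.1).le _)
    rw [reg.mollifyG_endpoint hε.1]
    refine Matrix.PosSemidef.add (Matrix.PosSemidef.smul ?_ (by linarith [hε.2]))
      (Matrix.PosSemidef.smul ?_ hε.1.le)
    · obtain ⟨C, hC⟩ := reg.exists_norm_kerX_le ε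
      exact integralScalar_posSemidef (hG i) (reg.measurable_kerX_sub ε _)
        (fun _ => reg.kerX_nonneg hε.1 _) fun _ => hC _
    · exact posSemidef_of_integral
        (F := fun z => reg.kerX ε (reg.invX ε x - z) • reg.lift z)
        (fun z => (reg.lift_psd z).smul (reg.kerX_nonneg hε.1 _))
        fun a b => reg.integrable_kerX_mul ε _ (reg.integrable_lift hΩ a b)
  · exact Matrix.PosSemidef.zero

theorem densG_endpoint_apply
    (hac : ∀ i, G i ≪ᵥ (volume : Measure (Eucl d)).toENNRealVectorMeasure) {ε : ℝ} (hε : 0 < ε)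
    (μ : TripleMeasure (ℝ × Eucl d) n k) (i : Fin 2) (x : Eucl d) (a b : Fin n) :
    reg.densG ε (G 0) (G 1) μ ((i : ℕ) : ℝ) x a b = {x | reg.invX ε x ∈ reg.window ε}.indicator
      (fun x => (1 - ε) * reg.smooth ε (lebesgueDensity (G i) a b) x +
        ε * reg.smooth ε (fun z => reg.lift z a b) x) x := by
  obtain ⟨C, hC⟩ := reg.exists_norm_kerX_le ε
  rw [densG, compress]
  by_cases hx : reg.invX ε x ∈ reg.window ε
  · rw [if_pos hx, indicator_of_mem (show x ∈ {x | reg.invX ε x ∈ reg.window ε} from hx),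
      reg.mollifyG_endpoint hε, Matrix.smul_apply, Matrix.add_apply, Matrix.smul_apply,
      Matrix.smul_apply, Matrix.of_apply, integralScalar_apply_eq_integral (hac i)
        (reg.measurable_kerX_sub ε _) (fun _ => hC _), smooth, smooth]
    simp only [smul_eq_mul]
    ring
  · rw [if_neg hx, indicator_of_notMem (show x ∉ {x | reg.invX ε x ∈ reg.window ε} from hx),
      Matrix.zero_apply]

/-- A point outside the window is farther than `ε` from all of `Ω`, where the measure lives. Hence
the restriction to the window removes nothing from the mollification of `H`. -/
theorem smooth_eq_zero_of_notMem_window (hΩ : IsCompact Ω)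
    {H : VectorMeasure (Eucl d) (Mat n n)} (hH : ConcentratedOn Ω H)
    (hac : H ≪ᵥ (volume : Measure (Eucl d)).toENNRealVectorMeasure) {ε : ℝ} (hε : 0 < ε)
    {x : Eucl d} (hx : reg.invX ε x ∉ reg.window ε) (a b : Fin n) :
    reg.smooth ε (lebesgueDensity H a b) x = 0 := by
  obtain ⟨C, hC⟩ := reg.exists_norm_kerX_le ε
  rw [smooth, ← integralScalar_apply_eq_integral hac (reg.measurable_kerX_sub ε _)
    (fun _ => hC _), integralScalar, Matrix.of_apply, VectorMeasure.integral_eq_zero_of_ae, mul_zero]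
  have hae : ∀ᵐ z ∂(entry H a b).variation, z ∈ Ω := by
    rw [ae_iff]
    exact variation_entry_compl hΩ.isClosed.measurableSet hH a b
  filter_upwards [hae] with z hz
  refine reg.kerX_eq_zero hε (not_le.1 fun h => hx (reg.window_sup ε ?_))
  refine Metric.mem_cthickening_of_dist_le _ z ε Ω hz ?_
  rwa [dist_eq_norm]

/-- An upper bound for the `L¹` distance between the regularized and the given endpoints. -/
def endpointError (G : VectorMeasure (Eucl d) (Mat n n)) (ε : ℝ) (a b : Fin n) : ℝ≥0∞ :=
  (∫⁻ x, ‖reg.smooth ε (lebesgueDensity G a b) x - lebesgueDensity G a b x‖ₑ) +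
    ENNReal.ofReal ε * ((∫⁻ x, ‖lebesgueDensity G a b x‖ₑ) + ∫⁻ x, ‖reg.lift x a b‖ₑ)

theorem tendsto_endpointError (hΩ : IsCompact Ω) (G : VectorMeasure (Eucl d) (Mat n n))
    (a b : Fin n) : Tendsto (fun ε => reg.endpointError G ε a b) (𝓝[>] 0) (𝓝 0) := by
  have h1 := reg.tendsto_lintegral_smooth_sub ((entry G a b).measurable_rnDeriv volume)
    ((entry G a b).integrable_rnDeriv volume)
  have hfin : (∫⁻ x, ‖lebesgueDensity G a b x‖ₑ) + ∫⁻ x, ‖reg.lift x a b‖ₑ ≠ ⊤ :=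
    ENNReal.add_ne_top.2 ⟨((entry G a b).integrable_rnDeriv volume).2.ne,
      (reg.integrable_lift hΩ a b).2.ne⟩
  have h2 : Tendsto (fun ε : ℝ => ENNReal.ofReal ε) (𝓝[>] 0) (𝓝 0) := by
    have := (ENNReal.continuous_ofReal.tendsto 0).mono_left (nhdsWithin_le_nhds (s := Ioi 0))
    rwa [ENNReal.ofReal_zero] at this
  have h3 := ENNReal.Tendsto.mul_const h2 (Or.inr hfin)
  rw [zero_mul] at h3
  have := h1.add h3
  rwa [zero_add] at this

theorem lintegral_densG_sub_le (hΩ : IsCompact Ω) (hc : ∀ i, ConcentratedOn Ω (G i))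
    (hac : ∀ i, G i ≪ᵥ (volume : Measure (Eucl d)).toENNRealVectorMeasure) {ε : ℝ} (hε : 0 < ε)
    (μ : TripleMeasure (ℝ × Eucl d) n k) (i : Fin 2) (a b : Fin n) :
    ∫⁻ x, ‖lebesgueDensity (G i) a b x - reg.densG ε (G 0) (G 1) μ ((i : ℕ) : ℝ) x a b‖ₑ ≤
      reg.endpointError (G i) ε a b := by
  set g := lebesgueDensity (G i) a b with hg
  set l : Eucl d → ℝ := fun z => reg.lift z a b with hl
  have hgm : Measurable g := (entry (G i) a b).measurable_rnDeriv volume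
  have hlm : Measurable l := reg.measurable_lift a b
  have hsg := reg.measurable_smooth ε hgm
  -- Inside the window the lift and the weight `1 - ε` contribute the terms with factor `ε`.
  -- Outside, the regularized density is zero and so is the mollified `g`, leaving only the first
  -- term.
  have hpt : ∀ x, ‖g x - reg.densG ε (G 0) (G 1) μ ((i : ℕ) : ℝ) x a b‖ₑ ≤
      ‖reg.smooth ε g x - g x‖ₑ + ENNReal.ofReal ε *
        (‖reg.smooth ε g x‖ₑ + ‖reg.smooth ε l x‖ₑ) := by
    intro x
    rw [reg.densG_endpoint_apply hac hε]
    by_cases hx : reg.invX ε x ∈ reg.window ε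
    · rw [indicator_of_mem (show x ∈ {x | reg.invX ε x ∈ reg.window ε} from hx)]
      have e : g x - ((1 - ε) * reg.smooth ε g x + ε * reg.smooth ε l x) =
          (ε * reg.smooth ε g x - ε * reg.smooth ε l x) - (reg.smooth ε g x - g x) := by ring
      rw [e, add_comm]
      refine enorm_sub_le.trans (add_le_add (enorm_sub_le.trans_eq ?_) le_rfl)
      rw [enorm_mul, enorm_mul, Real.enorm_of_nonneg hε.le, mul_add]
    · rw [indicator_of_notMem (show x ∉ {x | reg.invX ε x ∈ reg.window ε} from hx),
        reg.smooth_eq_zero_of_notMem_window hΩ (hc i) (hac i) hε hx, sub_zero, zero_sub, enorm_neg]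
      exact le_add_right le_rfl
  refine (lintegral_mono hpt).trans ?_
  rw [lintegral_add_left (hsg.fun_sub hgm).enorm, lintegral_const_mul' _ _ ENNReal.ofReal_ne_top,
    lintegral_add_left hsg.enorm, endpointError]
  have h1 := reg.lintegral_smooth_le hε hgm
  have h2 := reg.lintegral_smooth_le hε hlm
  exact add_le_add le_rfl (mul_le_mul_right (add_le_add h1 h2) _)

theorem integrable_densG_endpoint (hΩ : IsCompact Ω)
    (hac : ∀ i, G i ≪ᵥ (volume : Measure (Eucl d)).toENNRealVectorMeasure) {ε : ℝ} (hε : 0 < ε)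
    (μ : TripleMeasure (ℝ × Eucl d) n k) (i : Fin 2) (a b : Fin n) :
    Integrable fun x => reg.densG ε (G 0) (G 1) μ ((i : ℕ) : ℝ) x a b := by
  simp only [reg.densG_endpoint_apply hac hε]
  refine Integrable.indicator ?_ ((reg.continuous_invX ε).measurable (reg.window_meas ε))
  exact ((reg.integrable_smooth hε ((entry (G i) a b).measurable_rnDeriv volume)
    ((entry (G i) a b).integrable_rnDeriv volume)).const_mul _).add
    ((reg.integrable_smooth hε (reg.measurable_lift a b) (reg.integrable_lift hΩ a b)).const_mul _)

end Regularizer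

/-! ### Assumption A* -/

namespace Mesh

variable {d n : ℕ} {Ω : Set (Eucl d)} (T : Mesh d Ω)

theorem sampleFun_posSemidef (hΩ : IsCompact Ω) {Φ : Eucl d → Mat n n}
    (h : ∀ x, (Φ x).PosSemidef) (hi : ∀ a b, Integrable fun x => Φ x a b) (v : T.vertices) :
    (T.sampleFun Φ v).PosSemidef := by
  refine Matrix.PosSemidef.smul ?_ (inv_nonneg.2 (T.nodeVol_pos hΩ v).le)
  have e : (Matrix.of fun i j => ∫ x in Ω, Φ x i j * T.hat v x : Mat n n) =
      Matrix.of fun i j => ∫ x in Ω, (T.hat v x • Φ x) i j := by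
    simp only [Matrix.smul_apply, smul_eq_mul, mul_comm]
  rw [e]
  refine posSemidef_of_integral (fun x => (h x).smul (T.hat_nonneg v x)) fun a b => ?_
  exact (hi a b).integrableOn.bdd_mul (c := 1) (T.measurable_hat v).aestronglyMeasurable
    (Eventually.of_forall (T.norm_hat_le v))

/-- Sampling contracts `L¹` into the weighted `ℓ¹`: the weight cancels the normalization, and the
nodal functions are nonnegative with sum at most one. -/
theorem sum_abs_sample_sub_le (hΩ : IsCompact Ω) {G : VectorMeasure (Eucl d) (Mat n n)}
    (hac : G ≪ᵥ (volume : Measure (Eucl d)).toENNRealVectorMeasure) {Φ : Eucl d → Mat n n}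
    (hi : ∀ a b, Integrable fun x => Φ x a b) (a b : Fin n) :
    ENNReal.ofReal (∑ v, T.nodeVol v * |(T.sample G v - T.sampleFun Φ v) a b|) ≤
      ∫⁻ x, ‖lebesgueDensity G a b x - Φ x a b‖ₑ := by
  set g := lebesgueDensity G a b with hg
  have hgi : Integrable g := (entry G a b).integrable_rnDeriv volume
  have hmul : ∀ v {f : Eucl d → ℝ}, Integrable f → Integrable fun x => T.hat v x * f x :=
    fun v f hf => hf.bdd_mul (c := 1) (T.measurable_hat v).aestronglyMeasurable
      (Eventually.of_forall (T.norm_hat_le v))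
  have key : ∀ v, ENNReal.ofReal (T.nodeVol v * |(T.sample G v - T.sampleFun Φ v) a b|) ≤
      ∫⁻ x, ENNReal.ofReal (T.hat v x) * ‖g x - Φ x a b‖ₑ := by
    intro v
    have hv := T.nodeVol_pos hΩ v
    have e1 : ∫ x in Ω, Φ x a b * T.hat v x = ∫ x, T.hat v x * Φ x a b := by
      rw [setIntegral_eq_integral_of_forall_compl_eq_zero fun x hx => by
        rw [T.hat_eq_zero_of_notMem hx, mul_zero]]
      simp only [mul_comm]
    have e2 : T.nodeVol v * |(T.sample G v - T.sampleFun Φ v) a b| =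
        |∫ x, T.hat v x * (g x - Φ x a b)| := by
      rw [Matrix.sub_apply, sample, sampleFun, Matrix.smul_apply, Matrix.smul_apply,
        integralScalar_apply_eq_integral hac (T.measurable_hat v) (T.norm_hat_le v),
        Matrix.of_apply, e1, ← smul_sub, smul_eq_mul, abs_mul, abs_of_pos (inv_pos.2 hv),
        mul_inv_cancel_left₀ hv.ne']
      simp only [mul_sub]
      rw [integral_sub (hmul v hgi) (hmul v (hi a b))]
    rw [e2, ← Real.enorm_eq_ofReal_abs]
    refine (enorm_integral_le_lintegral_enorm _).trans_eq (lintegral_congr fun x => ?_)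
    rw [enorm_mul, Real.enorm_of_nonneg (T.hat_nonneg v x)]
  rw [ENNReal.ofReal_sum_of_nonneg fun v _ => mul_nonneg (T.nodeVol_pos hΩ v).le (abs_nonneg _)]
  refine (Finset.sum_le_sum fun v _ => key v).trans ?_
  have hm : AEMeasurable fun x => ‖g x - Φ x a b‖ₑ := (hgi.sub (hi a b)).aestronglyMeasurable.enorm
  rw [← lintegral_finsetSum' _ fun v _ => (T.measurable_hat v).ennreal_ofReal.aemeasurable.fun_mul hm]
  refine lintegral_mono fun x => ?_
  rw [← Finset.sum_mul, ← ENNReal.ofReal_sum_of_nonneg fun v _ => T.hat_nonneg v x]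
  refine mul_le_of_le_one_left bot_le ?_
  rw [← ENNReal.ofReal_one]
  exact ENNReal.ofReal_le_ofReal (T.sum_hat_le x)

/-- `frob_sub_self_le` at every vertex turns the quadratic distance of the roots into an `ℓ¹`
distance, the quantity controlled by the regularization. -/
theorem ofReal_sum_frob_msqrt_le (hΩ : IsCompact Ω) {G₀ G₁ : T.vertices → Mat n n}
    (h₀ : ∀ v, (G₀ v).PosSemidef) (h₁ : ∀ v, (G₁ v).PosSemidef) :
    ENNReal.ofReal (2 * ∑ v, T.nodeVol v *
      frob (msqrt (G₁ v) - msqrt (G₀ v)) (msqrt (G₁ v) - msqrt (G₀ v))) ≤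
    ENNReal.ofReal (2 * n) * ∑ a, ∑ b,
      ENNReal.ofReal (∑ v, T.nodeVol v * |(G₀ v - G₁ v) a b|) := by
  have hn : ∀ a b, 0 ≤ ∑ v, T.nodeVol v * |(G₀ v - G₁ v) a b| := fun a b =>
    Finset.sum_nonneg fun v _ => mul_nonneg (T.nodeVol_pos hΩ v).le (abs_nonneg _)
  have e : ∑ a, ∑ b, ENNReal.ofReal (∑ v, T.nodeVol v * |(G₀ v - G₁ v) a b|) =
      ENNReal.ofReal (∑ a, ∑ b, ∑ v, T.nodeVol v * |(G₀ v - G₁ v) a b|) := by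
    rw [ENNReal.ofReal_sum_of_nonneg fun a _ => Finset.sum_nonneg fun b _ => hn a b]
    exact Finset.sum_congr rfl fun a _ => (ENNReal.ofReal_sum_of_nonneg fun b _ => hn a b).symm
  rw [e, ← ENNReal.ofReal_mul (by positivity)]
  apply ENNReal.ofReal_le_ofReal
  have hv : ∀ v, frob (msqrt (G₁ v) - msqrt (G₀ v)) (msqrt (G₁ v) - msqrt (G₀ v)) ≤
      n * ∑ a, ∑ b, |(G₀ v - G₁ v) a b| := by
    intro v
    refine (frob_sub_self_le (msqrt_posSemidef _) (msqrt_posSemidef _)).trans_eq ?_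
    rw [msqrt_mul_self (h₀ v), msqrt_mul_self (h₁ v)]
    simp only [Matrix.sub_apply, abs_sub_comm]
  calc 2 * ∑ v, T.nodeVol v * frob (msqrt (G₁ v) - msqrt (G₀ v)) (msqrt (G₁ v) - msqrt (G₀ v))
      ≤ 2 * ∑ v, T.nodeVol v * (n * ∑ a, ∑ b, |(G₀ v - G₁ v) a b|) := by
        gcongr with v
        · exact (T.nodeVol_pos hΩ v).le
        · exact hv v
    _ = 2 * n * ∑ v, ∑ a, ∑ b, T.nodeVol v * |(G₀ v - G₁ v) a b| := by
        simp only [← Finset.mul_sum, mul_left_comm (T.nodeVol _) (n : ℝ), mul_assoc]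
    _ = 2 * n * ∑ a, ∑ b, ∑ v, T.nodeVol v * |(G₀ v - G₁ v) a b| := by
        rw [Finset.sum_comm]
        congr 1
        exact Finset.sum_congr rfl fun a _ => Finset.sum_comm

end Mesh

theorem assumptionAStar_sample {d n k : ℕ} {Ω : Set (Eucl d)} (hΩ : IsCompact Ω) {Sig : Set ℝ}
    (T : MeshFamily d Ω Sig) {D : DiffOp d n k} (reg : Regularizer Ω D)
    {G : Fin 2 → VectorMeasure (Eucl d) (Mat n n)} (hG : ∀ i, IsPSDMeasureOn Ω (G i))
    (hac : ∀ i, G i ≪ᵥ (volume : Measure (Eucl d)).toENNRealVectorMeasure) :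
    AssumptionAStar T D reg G fun i s => (T.mesh s).sample (G i) := by
  intro μ _ i
  have hcon : ∀ i, ConcentratedOn Ω (G i) := fun i => (hG i).1
  set Φ : ℝ → Eucl d → Mat n n := fun ε x => reg.densG ε (G 0) (G 1) μ ((i : ℕ) : ℝ) x with hΦ
  have hpsd₀ : ∀ (s : Sig) v, ((T.mesh s).sample (G i) v).PosSemidef := fun s v =>
    (T.mesh s).sample_posSemidef hΩ (hG i).2 v
  have hint : ∀ {ε}, 0 < ε → ∀ a b, Integrable fun x => Φ ε x a b := fun hε a b =>
    reg.integrable_densG_endpoint hΩ hac hε μ i a b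
  have hpsd₁ : ∀ {ε}, ε ∈ Ioo (0 : ℝ) 1 → ∀ (s : Sig) v,
      ((T.mesh s).sampleFun (Φ ε) v).PosSemidef := fun hε s v =>
    (T.mesh s).sampleFun_posSemidef hΩ
      (fun x => reg.posSemidef_densG_endpoint hΩ hε (fun i => (hG i).2) μ i x) (hint hε.1) v
  have hIoo : ∀ᶠ ε in 𝓝[>] (0 : ℝ), ε ∈ Ioo (0 : ℝ) 1 := Ioo_mem_nhdsGT zero_lt_one
  refine ⟨fun ε N s => (T.mesh s).rootCurve k N ((T.mesh s).sample (G i))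
    ((T.mesh s).sampleFun (Φ ε)), ?_, ?_⟩
  · filter_upwards [hIoo] with ε hε N hN s
    exact (T.mesh s).rootCurve_mem D hN (hpsd₀ s) (hpsd₁ hε s)
  -- The bound involves neither `N` nor the mesh, so it also bounds the upper limit.
  · set bound : ℝ → ℝ≥0∞ := fun ε => ENNReal.ofReal (2 * n) *
      ∑ a, ∑ b, reg.endpointError (G i) ε a b with hbound
    have hlim : Tendsto bound (𝓝[>] 0) (𝓝 0) := by
      have h1 : Tendsto (fun ε => ∑ a, ∑ b, reg.endpointError (G i) ε a b) (𝓝[>] 0)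
          (𝓝 (∑ _a : Fin n, ∑ _b : Fin n, 0)) :=
        tendsto_finsetSum _ fun a _ => tendsto_finsetSum _ fun b _ =>
          reg.tendsto_endpointError hΩ (G i) a b
      have h2 := ENNReal.Tendsto.const_mul h1 (Or.inr (ENNReal.ofReal_ne_top (r := 2 * n)))
      rwa [Finset.sum_eq_zero fun _ _ => Finset.sum_eq_zero fun _ _ => rfl, mul_zero] at h2
    refine tendsto_of_tendsto_of_tendsto_of_le_of_le' tendsto_const_nhds hlim
      (Eventually.of_forall fun _ => bot_le) ?_
    filter_upwards [hIoo] with ε hε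
    refine limsup_le_of_le (h := ?_)
    filter_upwards [(eventually_gt_atTop 0).prod_inl (toZero Sig)] with p hp
    refine ((T.mesh p.2).curveAction_rootCurve_le hΩ hp _ _).trans ?_
    refine ((T.mesh p.2).ofReal_sum_frob_msqrt_le hΩ (hpsd₀ p.2) (hpsd₁ hε p.2)).trans ?_
    refine mul_le_mul_right (Finset.sum_le_sum fun a _ => Finset.sum_le_sum fun b _ => ?_) _
    exact ((T.mesh p.2).sum_abs_sample_sub_le hΩ (hac i) (hint hε.1) a b).trans
      (reg.lintegral_densG_sub_le hΩ hcon hac hε.1 μ i a b)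

end MatrixOT

end

/-! ### Assembly of the theorem -/

open MatrixOT in
theorem mainTheorem7 {d n k : ℕ} (Ω : Set (Eucl d)) (hΩ : IsCompact Ω)
    (hΩ' : (interior Ω).Nonempty) (Sig : Set ℝ) (hpos : ∀ s ∈ Sig, 0 < s)
    (hacc : AccPt (0 : ℝ) (𝓟 Sig)) (T : MeshFamily d Ω Sig) (D : DiffOp d n k) :
    (∀ (s : Sig) (N : ℕ), 0 < N → ∀ G₀ G₁ : (T.mesh s).vertices → Mat n n,
      (∀ v, (G₀ v).PosSemidef) → (∀ v, (G₁ v).PosSemidef) →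
      (∃ μ ∈ (T.mesh s).discreteCE D N G₀ G₁,
        (T.mesh s).curveAction μ ≤ ENNReal.ofReal (2 * ∑ v, (T.mesh s).nodeVol v *
          frob (msqrt (G₁ v) - msqrt (G₀ v)) (msqrt (G₁ v) - msqrt (G₀ v)))) ∧
      (∃ μ ∈ (T.mesh s).discreteCE D N G₀ G₁, ∀ ν ∈ (T.mesh s).discreteCE D N G₀ G₁,
        (T.mesh s).curveAction μ ≤ (T.mesh s).curveAction ν)) ∧
    (∀ G : Fin 2 → VectorMeasure (Eucl d) (Mat n n), (∀ i, IsPSDMeasureOn Ω (G i)) →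
      (∀ i (s : Sig) v, ((T.mesh s).sample (G i) v).PosSemidef) ∧
      (∀ i, ∀ Φ : Eucl d → SymMat n, ContinuousOn Φ Ω →
        Tendsto (fun s : Sig =>
            pairing ((T.mesh s).recon ((T.mesh s).sample (G i))) fun x => (Φ x : Mat n n))
          (toZero Sig) (𝓝 (pairing (G i) fun x => (Φ x : Mat n n)))) ∧
      ((∀ i, G i ≪ᵥ (volume : Measure (Eucl d)).toENNRealVectorMeasure) →
        ∀ reg : Regularizer Ω D,
          AssumptionAStar T D reg G fun i s => (T.mesh s).sample (G i))) := by
  refine ⟨fun s N hN G₀ G₁ h₀ h₁ => ⟨⟨(T.mesh s).rootCurve k N G₀ G₁,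
    (T.mesh s).rootCurve_mem D hN h₀ h₁, (T.mesh s).curveAction_rootCurve_le hΩ hN G₀ G₁⟩,
    (T.mesh s).exists_minimizer hΩ D hN h₀ h₁⟩, fun G hG =>
    ⟨fun i s v => (T.mesh s).sample_posSemidef hΩ (hG i).2 v,
      fun i Φ hΦ => tendsto_pairing_recon_sample hΩ T (hG i).1 hΦ,
      fun hac reg => assumptionAStar_sample hΩ T reg hG hac⟩⟩
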